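/- Let $(X,\mathcal B,\mu)$ be a probability space and let $G$ be a finitely generated free abelian group acting on $X$ by $\mu$-preserving transformations. Assume that $G$ is totally weak mixing, i.e. every $g\in G$ with $g\neq\mathrm{id}$ acts as a weakly mixing transformation (meaning that $g\times g$ is ergodic on $(X\times X,\mathcal B\times\mathcal B,\mu\times\mu)$). Let $T_1,\dots,T_k\in G$ be different from the identity, and let $\hat T_1,\dots,\hat T_k$ be invertible $\mu$-preserving transformations of $X$ (with measurable inverses) which commute with each other and with $T_1,\dots,T_k$. Let $P_{ij}$, $1\le i\le\ell$, $1\le j\le k$, be polynomials taking integer values on the integers, and put $$\varphi_i(n)=T_1^{P_{i1}(n)}\cdots T_k^{P_{ik}(n)},\qquad i=1,\dots,\ell .$$ Suppose that each $\varphi_i$, and each $\varphi_i\varphi_j^{-1}$ with $i\ne j$, is a nonconstant map from $\mathbb Z$ to $G$. Let $Q_{ij}$, $1\le i\le \ell$, $1\le j\le k$, be arbitrary integer-valued functions of $N$. Then, for any bounded measurable (real- or complex-valued) functions $f_1,\dots,f_\ell$ on $X$, $$\lim_{N\to\infty}\frac1N\sum_{n=1}^N\prod_{i=1}^\ell \Big(T_1^{P_{i1}(n)}\cdots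 T_k^{P_{ik}(n)}\,\hat T_1^{Q_{i1}(N)}\cdots\hat T_k^{Q_{ik}(N)}f_i\Big)=\prod_{i=1}^\ell\int f_i\,d\mu\quad\text{in }L^2(X,\mu),$$ where a transformation $R$ of $X$ acts on functions by $(Rf)(x)=f(Rx)$. -/

import Mathlib

open MeasureTheory Filter Topology

/-- A transformation `T` of a measure space is weakly mixing if `T × T` is ergodic with respect
to the product measure (Mathlib's `Ergodic` includes that the map is measure preserving). -/
def WeaklyMixing {X : Type*} [MeasurableSpace X] (T : X → X) (μ : Measure X) : Prop :=
  Ergodic (Prod.map T T) (μ.prod μ)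

/-- The action of `G` is totally weak mixing: every element of `G` other than the identity acts
as a weakly mixing transformation. -/
def TotallyWeaklyMixing (G : Type*) {X : Type*} [Group G] [MulAction G X] [MeasurableSpace X]
    (μ : Measure X) : Prop :=
  ∀ g : G, g ≠ 1 → WeaklyMixing (fun x : X => g • x) μ

/-- `S` is an invertible `μ`-preserving transformation: a bijection of `X` which is measurable and
preserves `μ`, and so does its inverse. -/
def InvertibleMeasurePreserving {X : Type*} [MeasurableSpace X] (S : Equiv.Perm X)
    (μ : Measure X) : Prop :=
  MeasurePreserving S μ μ ∧ MeasurePreserving S.symm μ μ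

/-- `p : ℤ → ℤ` is given by a polynomial (with arbitrary real, not necessarily integer,
coefficients) taking integer values on the integers. -/
def IsIntegerValuedPolynomial (p : ℤ → ℤ) : Prop :=
  ∃ q : Polynomial ℝ, ∀ n : ℤ, q.eval (n : ℝ) = (p n : ℝ)

/-- The expression `φ(n) = T₁ ^ P₁(n) ⋯ Tₖ ^ Pₖ(n)` in the abelian group `G`. -/
def polyExpr {G : Type*} [CommGroup G] {k : ℕ} (T : Fin k → G) (P : Fin k → ℤ → ℤ) (n : ℤ) : G :=
  ∏ j, T j ^ P j n

/-- The transformation `ψ(N) = S₁ ^ Q₁(N) ∘ ⋯ ∘ Sₖ ^ Qₖ(N)` of `X`, composed in this order. -/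
def hatExpr {X : Type*} {k : ℕ} (S : Fin k → Equiv.Perm X) (Q : Fin k → ℕ → ℤ) (N : ℕ) :
    Equiv.Perm X :=
  (List.ofFn fun j => S j ^ Q j N).prod

/-- The average `(1 / N) ∑_{n = 1}^{N} ∏_{i = 1}^{ℓ} φᵢ(n) ψᵢ(N) fᵢ`, where a transformation `R`
acts on a function by `(R f)(x) = f (R x)`. -/
noncomputable def arrayAverage {𝕜 G X : Type*} [RCLike 𝕜] [CommGroup G] [MulAction G X] {k l : ℕ}
    (T : Fin k → G) (S : Fin k → Equiv.Perm X) (P : Fin l → Fin k → ℤ → ℤ)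
    (Q : Fin l → Fin k → ℕ → ℤ) (f : Fin l → X → 𝕜) (N : ℕ) (x : X) : 𝕜 :=
  (N : 𝕜)⁻¹ * ∑ n ∈ Finset.Icc 1 N,
    ∏ i, f i (polyExpr T (P i) (n : ℤ) • hatExpr S (Q i) N x)

/-!
The proof is van der Corput's inequality combined with PET induction.

By multilinearity (`convergesToProduct_of_zero_mean`) it suffices to treat functions bounded by
one, some `f i₀` having mean zero, and to show that the averages tend to zero. Van der Corput's
inequality (`integral_vanDerCorput`) bounds the `L²` norm of an average by averages over `n` of the
integrals of `u (n + h) * conj (u (n + h'))`, where `u` is the product being averaged and `h`, `h'`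
range over multiples of a large `M`. Such an integral is again the integral of a product along a
polynomial family (`familyProd_mul_conj`). An invariant change of variables divides that family by
a translate of its member `φ q` of least degree (`tendsto_average_integral_familyProd`); since the
exponents `Q` depend on `N` alone, the change of variables also absorbs them, which is why they may
be arbitrary. The new family satisfies the same nondegeneracy conditions, provided that the two
translates of a `φ i` of degree one, which differ by a constant, are merged
(`Admissible.correlation`), and its weight, the number of leading coefficients in each degree
compared from the highest degree down, is smaller (`polyWeight_lt`). By induction the correlation
converges to the product of the integrals of the new functions. For `φ i₀` of degree at least two,
one factor is `∫ f i₀ = 0`. For `φ i₀` of degree one, a factor is the correlation of `f i₀` with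
its translate by `(h' - h)` times the slope of `φ i₀`, and these are small on average by weak
mixing (`WeaklyMixing.tendsto_average_correlation`).

Polynomial sequences in an abelian group are handled through iterated differences, without
reference to polynomials. -/

/-! ### Polynomial sequences and their weights -/

section PolynomialSequences

variable {A : Type*} [AddCommGroup A]

/-- The `d`-th iterated difference `Δᵈ φ` of a sequence `φ : ℤ → A`, where
`Δ φ n = φ (n + 1) - φ n`. The equation `iterDiff d φ = 0` says that `φ` is a polynomial
sequence of degree less than `d`; this replaces polynomials with coefficients in an abelian group
throughout. -/
def iterDiff (d : ℕ) (φ : ℤ → A) : ℤ → A := (fwdDiff (1 : ℤ))^[d] φ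

lemma iterDiff_succ_apply (d : ℕ) (φ : ℤ → A) (n : ℤ) :
    iterDiff (d + 1) φ n = iterDiff d φ (n + 1) - iterDiff d φ n := by
  simp only [iterDiff, Function.iterate_succ_apply']; rfl

lemma iterDiff_one_apply (φ : ℤ → A) (n : ℤ) : iterDiff 1 φ n = φ (n + 1) - φ n := rfl

lemma iterDiff_add_eq (d e : ℕ) (φ : ℤ → A) : iterDiff (d + e) φ = iterDiff d (iterDiff e φ) :=
  Function.iterate_add_apply _ _ _ _

lemma iterDiff_sub_apply (d : ℕ) (φ χ : ℤ → A) (n : ℤ) :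
    iterDiff d (fun n => φ n - χ n) n = iterDiff d φ n - iterDiff d χ n := by
  induction d generalizing n with
  | zero => rfl
  | succ d ih => simp only [iterDiff_succ_apply, ih]; abel

lemma iterDiff_shift_apply (d : ℕ) (φ : ℤ → A) (h n : ℤ) :
    iterDiff d (fun n => φ (n + h)) n = iterDiff d φ (n + h) := by
  induction d generalizing n with
  | zero => rfl
  | succ d ih => simp only [iterDiff_succ_apply, ih]; rw [add_right_comm]

lemma iterDiff_zero_fun (d : ℕ) : iterDiff d (0 : ℤ → A) = 0 := by
  induction d with
  | zero => rfl
  | succ d ih => funext n; simp [iterDiff_succ_apply, ih]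

lemma iterDiff_eq_zero_of_le {d e : ℕ} (hde : d ≤ e) {φ : ℤ → A} (h : iterDiff d φ = 0) :
    iterDiff e φ = 0 := by
  obtain ⟨c, rfl⟩ := Nat.exists_eq_add_of_le' hde
  rw [iterDiff_add_eq, h, iterDiff_zero_fun]

lemma iterDiff_shift_eq_zero_iff (d : ℕ) (φ : ℤ → A) (h : ℤ) :
    iterDiff d (fun n => φ (n + h)) = 0 ↔ iterDiff d φ = 0 := by
  constructor
  · intro H; funext n
    have := congrFun H (n - h)
    rwa [iterDiff_shift_apply, sub_add_cancel] at this
  · intro H; funext n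
    rw [iterDiff_shift_apply, H]; rfl

lemma eq_add_zsmul_of_diff_eq {φ : ℤ → A} {c : A} (h : ∀ n, φ (n + 1) - φ n = c) (n e : ℤ) :
    φ (n + e) = φ n + e • c := by
  induction e using Int.induction_on with
  | zero => simp
  | succ i ih =>
    have := h (n + i)
    rw [← add_assoc, sub_eq_iff_eq_add.1 this, ih, add_smul, one_smul]; abel
  | pred i ih =>
    have := h (n + (-i - 1))
    rw [show n + (-(i : ℤ) - 1) + 1 = n + -i by ring, ih] at this
    rw [sub_smul, one_smul, ← add_sub_assoc (φ n), sub_eq_iff_eq_add.1 this, add_sub_cancel_left]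

lemma iterDiff_eq_const {d : ℕ} {φ : ℤ → A} (h : iterDiff (d + 1) φ = 0) (n m : ℤ) :
    iterDiff d φ n = iterDiff d φ m := by
  have := eq_add_zsmul_of_diff_eq (φ := iterDiff d φ) (c := 0)
    (fun n => by rw [← iterDiff_succ_apply, h]; rfl) m (n - m)
  simpa using this

lemma iterDiff_one_eq_zero_iff {φ : ℤ → A} : iterDiff 1 φ = 0 ↔ ∃ c, ∀ n, φ n = c := by
  constructor
  · intro h; exact ⟨φ 0, fun n => iterDiff_eq_const (d := 0) h n 0⟩
  · rintro ⟨c, hc⟩; funext n; simp [iterDiff_one_apply, hc]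

lemma linear_apply_add {φ : ℤ → A} (h : iterDiff 2 φ = 0) (n e : ℤ) :
    φ (n + e) = φ n + e • (φ 1 - φ 0) := by
  refine eq_add_zsmul_of_diff_eq (fun n => ?_) n e
  have := iterDiff_eq_const h n 0
  simpa [iterDiff_one_apply] using this

/-- A polynomial sequence of degree at least two with values in a torsion free group does not differ
from one of its proper translates by a constant. -/
lemma iterDiff_one_shift_sub_ne_zero [IsAddTorsionFree A] {φ : ℤ → A}
    (hpoly : ∃ d, iterDiff d φ = 0) (hφ : iterDiff 2 φ ≠ 0) {h h' : ℤ} (hh : h ≠ h') :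
    iterDiff 1 (fun n => φ (n + h) - φ (n + h')) ≠ 0 := by
  classical
  intro H
  have hspec := Nat.find_spec hpoly
  have hmin := fun m => Nat.find_min hpoly (m := m)
  generalize Nat.find hpoly = d at hspec hmin
  have hd : 3 ≤ d := by
    by_contra hlt
    exact hφ (iterDiff_eq_zero_of_le (by omega) hspec)
  obtain ⟨e, rfl⟩ := Nat.exists_eq_add_of_le' hd
  -- `Δ^(e+1) φ` is affine with nonzero slope, so a translation changes it.
  have hne : iterDiff (e + 2) φ 0 ≠ 0 := fun h0 =>
    hmin (e + 2) (by omega) (funext fun n => (iterDiff_eq_const hspec n 0).trans h0)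
  have haff := eq_add_zsmul_of_diff_eq (φ := iterDiff (e + 1) φ) (c := iterDiff (e + 2) φ 0)
    (fun n => by rw [← iterDiff_succ_apply]; exact iterDiff_eq_const hspec n 0)
  have h1 := congrFun (iterDiff_eq_zero_of_le (e := e + 1) (by omega) H) 0
  rw [iterDiff_sub_apply, iterDiff_shift_apply, iterDiff_shift_apply, haff, haff 0 h',
    add_sub_add_left_eq_sub, ← sub_smul] at h1
  rcases (smul_eq_zero (R := ℤ) (M := A)).1 h1 with h2 | h2
  · exact hh (sub_eq_zero.1 h2)
  · exact hne h2

/-- If `φ - χ` is not constant, then neither is the difference of `χ` and a translate of `φ`, except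
for finitely many translates. -/
lemma exists_bound_shift_sub_ne_zero [IsAddTorsionFree A] {φ χ : ℤ → A}
    (hpoly : ∃ d, iterDiff d φ = 0) (hne : iterDiff 1 (fun n => φ n - χ n) ≠ 0) :
    ∃ M : ℕ, ∀ e : ℤ, (M : ℤ) ≤ |e| → iterDiff 1 (fun n => φ (n + e) - χ n) ≠ 0 := by
  by_cases hlin : iterDiff 2 φ = 0
  · refine ⟨0, fun e _ H => hne ?_⟩
    obtain ⟨c, hc⟩ := iterDiff_one_eq_zero_iff.1 H
    refine iterDiff_one_eq_zero_iff.2 ⟨c - e • (φ 1 - φ 0), fun n => ?_⟩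
    rw [← hc n, linear_apply_add hlin]; abel
  · by_cases hex : ∃ e₀ : ℤ, iterDiff 1 (fun n => φ (n + e₀) - χ n) = 0
    · obtain ⟨e₀, he₀⟩ := hex
      obtain ⟨c₀, hc₀⟩ := iterDiff_one_eq_zero_iff.1 he₀
      refine ⟨e₀.natAbs + 1, fun e he H => ?_⟩
      have hee : e ≠ e₀ := by rintro rfl; push_cast at he; omega
      obtain ⟨c, hc⟩ := iterDiff_one_eq_zero_iff.1 H
      refine iterDiff_one_shift_sub_ne_zero hpoly hlin hee
        (iterDiff_one_eq_zero_iff.2 ⟨c - c₀, fun n => ?_⟩)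
      rw [← hc n, ← hc₀ n]; abel
    · exact ⟨0, fun e _ H => hex ⟨e, H⟩⟩

/-- A common spacing `M ≥ 1`: translates of distinct members of the family by different multiples of
`M` never differ by a constant. -/
lemma exists_spacing [IsAddTorsionFree A] {ι : Type*} (s : Finset ι) (φ : ι → ℤ → A)
    (hpoly : ∀ i ∈ s, ∃ d, iterDiff d (φ i) = 0)
    (hne : ∀ i ∈ s, ∀ j ∈ s, i ≠ j → iterDiff 1 (fun n => φ i n - φ j n) ≠ 0) :
    ∃ M : ℕ, 0 < M ∧ ∀ i ∈ s, ∀ j ∈ s, i ≠ j → ∀ t t' : ℤ, t ≠ t' →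
      iterDiff 1 (fun n => φ i (n + t * M) - φ j (n + t' * M)) ≠ 0 := by
  classical
  have key : ∀ i j, ∃ M : ℕ, i ∈ s → j ∈ s → i ≠ j → ∀ e : ℤ, (M : ℤ) ≤ |e| →
      iterDiff 1 (fun n => φ i (n + e) - φ j n) ≠ 0 := by
    intro i j
    by_cases h : i ∈ s ∧ j ∈ s ∧ i ≠ j
    · obtain ⟨M, hM⟩ := exists_bound_shift_sub_ne_zero (hpoly i h.1) (hne i h.1 j h.2.1 h.2.2)
      exact ⟨M, fun _ _ _ => hM⟩
    · exact ⟨0, fun h1 h2 h3 => absurd ⟨h1, h2, h3⟩ h⟩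
  choose m hm using key
  refine ⟨(∑ i ∈ s, ∑ j ∈ s, m i j) + 1, by omega, fun i hi j hj hij t t' htt H => ?_⟩
  have hle : m i j ≤ ∑ i ∈ s, ∑ j ∈ s, m i j :=
    (Finset.single_le_sum (f := fun j => m i j) (fun _ _ => Nat.zero_le _) hj).trans
      (Finset.single_le_sum (f := fun i => ∑ j ∈ s, m i j) (fun _ _ => Nat.zero_le _) hi)
  generalize (∑ i ∈ s, ∑ j ∈ s, m i j) = K at hle H
  refine hm i j hi hj hij ((t - t') * ((K + 1 : ℕ) : ℤ)) ?_ ?_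
  · rw [abs_mul, Nat.abs_cast]
    have h1 : (1 : ℤ) ≤ |t - t'| := Int.one_le_abs (sub_ne_zero.2 htt)
    have h2 : (m i j : ℤ) ≤ ((K + 1 : ℕ) : ℤ) := by exact_mod_cast hle.trans (Nat.le_succ K)
    nlinarith [(Nat.cast_nonneg (K + 1) : (0 : ℤ) ≤ ((K + 1 : ℕ) : ℤ))]
  · rw [← iterDiff_shift_eq_zero_iff 1 _ (t' * ((K + 1 : ℕ) : ℤ))]
    convert H using 5
    ring

end PolynomialSequences

section Weights

variable {A ι : Type*} [AddCommGroup A]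

open scoped Classical in
/-- The nonzero leading coefficients of the members of degree exactly `d` of a finite family of
polynomial sequences, where the leading coefficient of `φ` is normalized as `Δᵈ φ`. -/
noncomputable def leadingCoeffs (s : Finset ι) (φ : ι → ℤ → A) (d : ℕ) : Finset A :=
  ((s.filter fun i => iterDiff (d + 1) (φ i) = 0).image fun i => iterDiff d (φ i) 0).erase 0

lemma mem_leadingCoeffs {s : Finset ι} {φ : ι → ℤ → A} {d : ℕ} {c : A} :
    c ∈ leadingCoeffs s φ d ↔
      c ≠ 0 ∧ ∃ i ∈ s, iterDiff (d + 1) (φ i) = 0 ∧ iterDiff d (φ i) 0 = c := by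
  simp [leadingCoeffs, and_assoc]

/-- The weight of a family of polynomial sequences of degree less than `D`: the number of leading
coefficients in each degree. Weights are compared colexicographically, high degrees first. -/
noncomputable def polyWeight (D : ℕ) (s : Finset ι) (φ : ι → ℤ → A) : Colex (Fin D → ℕ) :=
  toColex fun d => (leadingCoeffs s φ d).card

lemma exists_minimal_degree {s : Finset ι} {φ : ι → ℤ → A} {D : ℕ} (hs : s.Nonempty)
    (hpoly : ∀ i ∈ s, iterDiff D (φ i) = 0) (hne : ∀ i ∈ s, iterDiff 1 (φ i) ≠ 0) :
    ∃ m, 0 < m ∧ m < D ∧ (∀ i ∈ s, iterDiff m (φ i) ≠ 0) ∧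
      ∃ q ∈ s, iterDiff (m + 1) (φ q) = 0 := by
  classical
  obtain ⟨i₀, hi₀⟩ := hs
  have hex : ∃ d, ∃ i ∈ s, iterDiff d (φ i) = 0 := ⟨D, i₀, hi₀, hpoly i₀ hi₀⟩
  have hspec := Nat.find_spec hex
  have hmin := fun m => Nat.find_min hex (m := m)
  have hle : Nat.find hex ≤ D := Nat.find_min' hex ⟨i₀, hi₀, hpoly i₀ hi₀⟩
  generalize Nat.find hex = d at hspec hmin hle
  obtain ⟨q, hq, hq0⟩ := hspec
  have hd : 2 ≤ d := by
    by_contra h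
    exact hne q hq (iterDiff_eq_zero_of_le (by omega) hq0)
  refine ⟨d - 1, by omega, by omega, fun i hi h0 => hmin (d - 1) (by omega) ⟨i, hi, h0⟩, q, hq, ?_⟩
  rwa [Nat.sub_add_cancel (by omega)]

/-- The combinatorial heart of PET induction: let `φ q` have minimal degree in the family `s`, and
let `t` be a family of translates of members of `s`, containing a translate of each member except
possibly `φ q`. Replacing `t` by the differences with a translate of `φ q` lowers the weight:
leading coefficients in degrees above `deg (φ q)` are unchanged, and in degree `deg (φ q)` they are
translated by the one of `φ q`, which becomes zero. -/
lemma polyWeight_lt {κ : Type*} {s : Finset ι} {φ : ι → ℤ → A} {D m : ℕ} (hm : m < D)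
    (hdeg : ∀ i ∈ s, iterDiff m (φ i) ≠ 0) {q : ι} (hq : q ∈ s)
    (hq0 : iterDiff (m + 1) (φ q) = 0) {t : Finset κ} {π : κ → ι} {σ : κ → ℤ} {h : ℤ}
    (hπ : ∀ p ∈ t, π p ∈ s) (hsurj : ∀ i ∈ s, i ≠ q → ∃ p ∈ t, π p = i) :
    polyWeight D t (fun p n => φ (π p) (n + σ p) - φ q (n + h)) < polyWeight D s φ := by
  classical
  have hval : ∀ d p n, iterDiff d (fun n => φ (π p) (n + σ p) - φ q (n + h)) n
      = iterDiff d (φ (π p)) (n + σ p) - iterDiff d (φ q) (n + h) := fun d p n => by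
    rw [iterDiff_sub_apply, iterDiff_shift_apply, iterDiff_shift_apply]
  have hhigh : ∀ d, m + 1 ≤ d → ∀ p n, iterDiff d (fun n => φ (π p) (n + σ p) - φ q (n + h)) n
      = iterDiff d (φ (π p)) (n + σ p) := fun d hd p n => by
    rw [hval, iterDiff_eq_zero_of_le hd hq0]; simp
  have hiff : ∀ d, m + 1 ≤ d → ∀ p, iterDiff d (fun n => φ (π p) (n + σ p) - φ q (n + h)) = 0 ↔
      iterDiff d (φ (π p)) = 0 := fun d hd p => by
    rw [← iterDiff_shift_eq_zero_iff d (φ (π p)) (σ p)]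
    refine Eq.congr_left (funext fun n => ?_)
    rw [hhigh d hd, iterDiff_shift_apply]
  refine ⟨⟨m, hm⟩, fun j hj => ?_, ?_⟩
  · change (leadingCoeffs _ _ _).card = (leadingCoeffs _ _ _).card
    have hj' : m + 1 ≤ (j : ℕ) := hj
    congr 1
    ext c
    simp only [mem_leadingCoeffs]
    refine and_congr_right fun hc => ⟨?_, ?_⟩
    · rintro ⟨p, hp, h1, h2⟩
      rw [hiff _ (by omega)] at h1
      refine ⟨π p, hπ p hp, h1, ?_⟩
      rw [← h2, hhigh _ hj']
      exact iterDiff_eq_const h1 _ _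
    · rintro ⟨i, hi, h1, h2⟩
      have hiq : i ≠ q := by
        rintro rfl
        exact hc (by rw [← h2, iterDiff_eq_zero_of_le hj' hq0]; rfl)
      obtain ⟨p, hp, rfl⟩ := hsurj i hi hiq
      refine ⟨p, hp, (hiff _ (by omega) p).2 h1, ?_⟩
      rw [← h2, hhigh _ hj']
      exact iterDiff_eq_const h1 _ _
  · change (leadingCoeffs _ _ m).card < (leadingCoeffs _ _ m).card
    have hmem : iterDiff m (φ q) 0 ∈ leadingCoeffs s φ m := by
      refine mem_leadingCoeffs.2 ⟨fun h0 => hdeg q hq (funext fun n => ?_), q, hq, hq0, rfl⟩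
      rw [iterDiff_eq_const hq0 n 0, h0]; rfl
    have hsub : leadingCoeffs t (fun p n => φ (π p) (n + σ p) - φ q (n + h)) m ⊆
        ((leadingCoeffs s φ m).erase (iterDiff m (φ q) 0)).image (· - iterDiff m (φ q) 0) := by
      intro c hc
      obtain ⟨hc0, p, hp, h1, h2⟩ := mem_leadingCoeffs.1 hc
      rw [hiff _ le_rfl] at h1
      rw [hval, iterDiff_eq_const h1 _ 0, iterDiff_eq_const hq0 _ 0] at h2
      refine Finset.mem_image.2 ⟨iterDiff m (φ (π p)) 0, Finset.mem_erase.2 ⟨?_, ?_⟩, h2⟩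
      · intro heq; exact hc0 (by rw [← h2, heq, sub_self])
      · refine mem_leadingCoeffs.2
          ⟨fun h0 => hdeg _ (hπ p hp) (funext fun n => ?_), π p, hπ p hp, h1, rfl⟩
        rw [iterDiff_eq_const h1 n 0, h0]; rfl
    calc _ ≤ _ := Finset.card_le_card hsub
      _ ≤ _ := Finset.card_image_le
      _ < _ := Finset.card_erase_lt_of_mem hmem

end Weights

/-! ### Van der Corput's inequality and weak mixing -/

section VanDerCorput

variable {𝕜 : Type*} [RCLike 𝕜]

lemma sum_Icc_one_eq_sum_range {M : Type*} [AddCommMonoid M] (g : ℕ → M) (N : ℕ) :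
    ∑ n ∈ Finset.Icc 1 N, g n = ∑ n ∈ Finset.range N, g (n + 1) := by
  rw [Finset.range_eq_Ico, Finset.sum_Ico_add', zero_add]; rfl

lemma norm_sum_shift_sub_le (v : ℤ → 𝕜) (hv : ∀ n, ‖v n‖ ≤ 1) (N m : ℕ) :
    ‖∑ n ∈ Finset.Icc 1 N, v n - ∑ n ∈ Finset.Icc 1 N, v (n + m)‖ ≤ 2 * m := by
  induction m with
  | zero => simp
  | succ m ih =>
    have h1 : ∑ n ∈ Finset.Icc 1 N, v (n + m) - ∑ n ∈ Finset.Icc 1 N, v (n + (m + 1 : ℕ))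
        = v (1 + m) - v (N + 1 + m) := by
      rw [sum_Icc_one_eq_sum_range (fun n : ℕ => v (n + m)),
        sum_Icc_one_eq_sum_range (fun n : ℕ => v (n + (m + 1 : ℕ))), ← Finset.sum_sub_distrib]
      have := Finset.sum_range_sub' (fun n : ℕ => v (n + 1 + m)) N
      simp only [Nat.cast_zero, zero_add] at this
      rw [← this]
      refine Finset.sum_congr rfl fun n _ => ?_
      rw [show ((n + 1 : ℕ) : ℤ) + ((m + 1 : ℕ) : ℤ) = ((n + 1 : ℕ) : ℤ) + 1 + m by
        push_cast; ring]
      push_cast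
      rfl
    rw [← sub_add_sub_cancel _ (∑ n ∈ Finset.Icc 1 N, v (n + m)), h1]
    refine (norm_add_le _ _).trans ((add_le_add ih (norm_sub_le _ _)).trans ?_)
    push_cast
    linarith [hv (1 + m), hv (N + 1 + m)]

lemma norm_sum_sq_eq {α : Type*} (s : Finset α) (w : α → 𝕜) :
    ‖∑ t ∈ s, w t‖ ^ 2 = ∑ t ∈ s, ∑ t' ∈ s, RCLike.re (w t * starRingEnd 𝕜 (w t')) := by
  have : ((‖∑ t ∈ s, w t‖ ^ 2 : ℝ) : 𝕜) = ∑ t ∈ s, ∑ t' ∈ s, w t * starRingEnd 𝕜 (w t') := by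
    rw [RCLike.ofReal_pow, ← RCLike.mul_conj, map_sum, Finset.sum_mul_sum]
  have h2 := congrArg RCLike.re this
  rw [RCLike.ofReal_re] at h2
  simpa only [map_sum] using h2

lemma norm_average_sq_le {α : Type*} (s : Finset α) (w : α → 𝕜) :
    ‖(s.card : 𝕜)⁻¹ * ∑ t ∈ s, w t‖ ^ 2 ≤ (s.card : ℝ)⁻¹ * ∑ t ∈ s, ‖w t‖ ^ 2 := by
  rcases s.eq_empty_or_nonempty with rfl | hs
  · simp
  have hc : (0 : ℝ) < s.card := by exact_mod_cast hs.card_pos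
  have h1 : ‖∑ t ∈ s, w t‖ ^ 2 ≤ s.card * ∑ t ∈ s, ‖w t‖ ^ 2 :=
    (pow_le_pow_left₀ (norm_nonneg _) (norm_sum_le _ _) 2).trans sq_sum_le_card_mul_sum_sq
  rw [norm_mul, norm_inv, RCLike.norm_natCast, mul_pow]
  calc _ ≤ ((s.card : ℝ)⁻¹) ^ 2 * (s.card * ∑ t ∈ s, ‖w t‖ ^ 2) := by gcongr
    _ = _ := by field_simp

/-- Van der Corput's inequality for a bounded sequence of scalars, with the shifts `0, M, 2M, …`. -/
lemma vanDerCorput (v : ℤ → 𝕜) (hv : ∀ n, ‖v n‖ ≤ 1) {H N : ℕ} (M : ℕ) (hH : 0 < H) (hN : 0 < N) :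
    ‖(N : 𝕜)⁻¹ * ∑ n ∈ Finset.Icc 1 N, v n‖ ^ 2 ≤
      2 * ((H : ℝ)⁻¹ ^ 2 * ∑ t ∈ Finset.range H, ∑ t' ∈ Finset.range H,
        (N : ℝ)⁻¹ * ∑ n ∈ Finset.Icc 1 N,
          RCLike.re (v (n + t * M) * starRingEnd 𝕜 (v (n + t' * M))))
      + 8 * (H * M / N) ^ 2 := by
  have hN' : (0 : ℝ) < N := by exact_mod_cast hN
  have hH' : (0 : ℝ) < H := by exact_mod_cast hH
  have hNk : (N : 𝕜) ≠ 0 := by exact_mod_cast hN.ne'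
  have hHk : (H : 𝕜) ≠ 0 := by exact_mod_cast hH.ne'
  set a : 𝕜 := (N : 𝕜)⁻¹ * ∑ n ∈ Finset.Icc 1 N, v n with ha
  set w : ℕ → 𝕜 := fun n => (H : 𝕜)⁻¹ * ∑ t ∈ Finset.range H, v (n + t * M) with hw
  set B : 𝕜 := (N : 𝕜)⁻¹ * ∑ n ∈ Finset.Icc 1 N, w n with hB
  have hdiff : ‖a - B‖ ≤ 2 * (H * M / N) := by
    have e1 : a - B = (H : 𝕜)⁻¹ * ∑ t ∈ Finset.range H, (N : 𝕜)⁻¹ *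
        (∑ n ∈ Finset.Icc 1 N, v n - ∑ n ∈ Finset.Icc 1 N, v (n + (t * M : ℕ))) := by
      have e2 : a = (H : 𝕜)⁻¹ * ∑ t ∈ Finset.range H, a := by
        simp [hHk]
      have e3 : B = (H : 𝕜)⁻¹ * ∑ t ∈ Finset.range H,
          (N : 𝕜)⁻¹ * ∑ n ∈ Finset.Icc 1 N, v (n + (t * M : ℕ)) := by
        simp only [hB, hw, ← Finset.mul_sum]
        rw [Finset.sum_comm]
        push_cast
        ring
      simp only [mul_sub, Finset.sum_sub_distrib]
      rw [e3, e2]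
    rw [e1, norm_mul, norm_inv, RCLike.norm_natCast]
    have : ‖∑ t ∈ Finset.range H, (N : 𝕜)⁻¹ *
        (∑ n ∈ Finset.Icc 1 N, v n - ∑ n ∈ Finset.Icc 1 N, v (n + (t * M : ℕ)))‖
        ≤ ∑ t ∈ Finset.range H, (N : ℝ)⁻¹ * (2 * (H * M)) := by
      refine norm_sum_le_of_le _ fun t ht => ?_
      rw [norm_mul, norm_inv, RCLike.norm_natCast]
      refine mul_le_mul_of_nonneg_left ((norm_sum_shift_sub_le v hv N (t * M)).trans ?_)
        (by positivity)
      have : (t : ℝ) ≤ H := by exact_mod_cast (Finset.mem_range.1 ht).le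
      push_cast
      gcongr
    calc _ ≤ (H : ℝ)⁻¹ * ∑ t ∈ Finset.range H, (N : ℝ)⁻¹ * (2 * (H * M)) := by gcongr
      _ = _ := by
        rw [Finset.sum_const, Finset.card_range, nsmul_eq_mul]; field_simp
  have hBsq : ‖B‖ ^ 2 ≤ (H : ℝ)⁻¹ ^ 2 * ∑ t ∈ Finset.range H, ∑ t' ∈ Finset.range H,
        (N : ℝ)⁻¹ * ∑ n ∈ Finset.Icc 1 N,
          RCLike.re (v (n + t * M) * starRingEnd 𝕜 (v (n + t' * M))) := by
    have h1 := norm_average_sq_le (Finset.Icc 1 N) w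
    rw [Nat.card_Icc, Nat.add_sub_cancel] at h1
    refine h1.trans (le_of_eq ?_)
    simp only [hw, norm_mul, norm_inv, RCLike.norm_natCast, mul_pow, norm_sum_sq_eq,
      ← Finset.mul_sum]
    rw [Finset.sum_comm, Finset.sum_congr rfl fun t _ => Finset.sum_comm]
    ring
  have htri : ‖a‖ ^ 2 ≤ 2 * ‖B‖ ^ 2 + 2 * ‖a - B‖ ^ 2 := by
    have h1 : ‖a‖ ≤ ‖B‖ + ‖a - B‖ := by
      simpa using norm_add_le B (a - B)
    nlinarith [norm_nonneg a, sq_nonneg (‖B‖ - ‖a - B‖), norm_nonneg B, norm_nonneg (a - B)]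
  have hd2 : ‖a - B‖ ^ 2 ≤ (2 * (H * M / N)) ^ 2 := pow_le_pow_left₀ (norm_nonneg _) hdiff 2
  nlinarith

end VanDerCorput

section BoundedMeasurable

variable {𝕜 X Y : Type*} [RCLike 𝕜] [MeasurableSpace X] [MeasurableSpace Y]

/-- `f` is measurable and bounded everywhere. -/
structure BddMeasurable (f : X → 𝕜) : Prop where
  measurable : Measurable f
  bdd : ∃ C : ℝ, ∀ x, ‖f x‖ ≤ C

namespace BddMeasurable

variable {f g : X → 𝕜}

lemma const (c : 𝕜) : BddMeasurable fun _ : X => c := ⟨measurable_const, ‖c‖, fun _ => le_rfl⟩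

lemma comp (hf : BddMeasurable f) {T : Y → X} (hT : Measurable T) :
    BddMeasurable fun y => f (T y) :=
  ⟨hf.1.comp hT, hf.2.imp fun _ h y => h (T y)⟩

lemma add (hf : BddMeasurable f) (hg : BddMeasurable g) : BddMeasurable fun x => f x + g x := by
  obtain ⟨hf1, C, hC⟩ := hf
  obtain ⟨hg1, D, hD⟩ := hg
  exact ⟨hf1.add hg1, C + D, fun x => (norm_add_le _ _).trans (add_le_add (hC x) (hD x))⟩

lemma mul (hf : BddMeasurable f) (hg : BddMeasurable g) : BddMeasurable fun x => f x * g x := by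
  obtain ⟨hf1, C, hC⟩ := hf
  obtain ⟨hg1, D, hD⟩ := hg
  refine ⟨hf1.mul hg1, C * D, fun x => ?_⟩
  rw [norm_mul]
  exact mul_le_mul (hC x) (hD x) (norm_nonneg _) ((norm_nonneg _).trans (hC x))

lemma sub (hf : BddMeasurable f) (hg : BddMeasurable g) : BddMeasurable fun x => f x - g x := by
  simpa [sub_eq_add_neg] using hf.add ((const (-1)).mul hg)

lemma conj (hf : BddMeasurable f) : BddMeasurable fun x => starRingEnd 𝕜 (f x) :=
  ⟨RCLike.continuous_conj.measurable.comp hf.1, hf.2.imp fun _ h x => by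
    rw [RCLike.norm_conj]; exact h x⟩

lemma sum {ι : Type*} (s : Finset ι) {F : ι → X → 𝕜} (h : ∀ i ∈ s, BddMeasurable (F i)) :
    BddMeasurable fun x => ∑ i ∈ s, F i x := by
  classical
  induction s using Finset.induction_on with
  | empty => simpa using const (0 : 𝕜)
  | insert a s ha ih =>
    simp only [Finset.sum_insert ha]
    exact (h a (by simp)).add (ih fun i hi => h i (by simp [hi]))

lemma prod {ι : Type*} (s : Finset ι) {F : ι → X → 𝕜} (h : ∀ i ∈ s, BddMeasurable (F i)) :
    BddMeasurable fun x => ∏ i ∈ s, F i x := by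
  classical
  induction s using Finset.induction_on with
  | empty => simpa using const (1 : 𝕜)
  | insert a s ha ih =>
    simp only [Finset.prod_insert ha]
    exact (h a (by simp)).mul (ih fun i hi => h i (by simp [hi]))

lemma norm_sq (hf : BddMeasurable f) : BddMeasurable fun x => ‖f x‖ ^ 2 := by
  obtain ⟨hf1, C, hC⟩ := hf
  refine ⟨hf1.norm.pow_const 2, C ^ 2, fun x => ?_⟩
  rw [Real.norm_of_nonneg (by positivity)]
  exact pow_le_pow_left₀ (norm_nonneg _) (hC x) 2

lemma norm (hf : BddMeasurable f) : BddMeasurable fun x => ‖f x‖ :=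
  ⟨hf.1.norm, hf.2.imp fun _ h x => by rw [norm_norm]; exact h x⟩

lemma re (hf : BddMeasurable f) : BddMeasurable fun x => RCLike.re (f x) :=
  ⟨RCLike.continuous_re.measurable.comp hf.1, hf.2.imp fun _ h x =>
    (RCLike.norm_re_le_norm _).trans (h x)⟩

lemma memLp (hf : BddMeasurable f) (μ : Measure X) [IsFiniteMeasure μ] (p : ENNReal) :
    MemLp f p μ :=
  let ⟨C, hC⟩ := hf.2
  MemLp.of_bound hf.1.aestronglyMeasurable C (Eventually.of_forall hC)

lemma integrable (hf : BddMeasurable f) (μ : Measure X) [IsFiniteMeasure μ] : Integrable f μ :=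
  memLp_one_iff_integrable.1 (hf.memLp μ 1)

lemma integral_comp (hf : BddMeasurable f) {μ : Measure X} {ν : Measure Y} {T : Y → X}
    (hT : MeasurePreserving T ν μ) : ∫ y, f (T y) ∂ν = ∫ x, f x ∂μ := by
  rw [← hT.map_eq, integral_map hT.measurable.aemeasurable hf.1.aestronglyMeasurable]

lemma norm_integral_sq_le (hf : BddMeasurable f) (μ : Measure X) [IsProbabilityMeasure μ] :
    ‖∫ x, f x ∂μ‖ ^ 2 ≤ ∫ x, ‖f x‖ ^ 2 ∂μ := by
  have h1 : ‖∫ x, f x ∂μ‖ ≤ ∫ x, ‖f x‖ ∂μ := norm_integral_le_integral_norm _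
  have h2 : 0 ≤ ∫ x, (‖f x‖ - ∫ y, ‖f y‖ ∂μ) ^ 2 ∂μ := integral_nonneg fun x => sq_nonneg _
  have h3 : ∫ x, (‖f x‖ - ∫ y, ‖f y‖ ∂μ) ^ 2 ∂μ
      = ∫ x, ‖f x‖ ^ 2 ∂μ - (∫ y, ‖f y‖ ∂μ) ^ 2 := by
    set c := ∫ y, ‖f y‖ ∂μ with hc
    have : ∀ x, (‖f x‖ - c) ^ 2 = ‖f x‖ ^ 2 - ((2 * c) * ‖f x‖ - c ^ 2) := fun x => by ring
    have hi : Integrable (fun x => 2 * c * ‖f x‖ - c ^ 2) μ :=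
      ((hf.norm.integrable μ).const_mul _).sub (integrable_const _)
    simp only [this]
    rw [integral_sub (hf.norm_sq.integrable μ) hi,
      integral_sub ((hf.norm.integrable μ).const_mul _) (integrable_const _),
      integral_const_mul, ← hc]
    simp
    ring
  nlinarith [pow_le_pow_left₀ (norm_nonneg (∫ x, f x ∂μ)) h1 2]

end BddMeasurable

end BoundedMeasurable

section WeakMixing

variable {𝕜 X : Type*} [RCLike 𝕜] [MeasurableSpace X] {μ : Measure X} [IsProbabilityMeasure μ]

/-- The mean ergodic theorem for an ergodic map: the ergodic averages of a function of mean zero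
tend to zero in `L²`. -/
lemma tendsto_ergodic_average {R : X → X} (hR : Ergodic R μ) {F : X → 𝕜} (hF : BddMeasurable F)
    (hF0 : ∫ x, F x ∂μ = 0) :
    Tendsto (fun H : ℕ => ∫ x, ‖(H : 𝕜)⁻¹ * ∑ t ∈ Finset.range H, F (R^[t] x)‖ ^ 2 ∂μ)
      atTop (𝓝 0) := by
  have hRm := hR.toMeasurePreserving
  set K : Lp 𝕜 2 μ →L[𝕜] Lp 𝕜 2 μ :=
    (Lp.compMeasurePreservingₗᵢ 𝕜 R hRm).toContinuousLinearMap with hK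
  have hKn : ‖K‖ ≤ 1 := LinearIsometry.norm_toContinuousLinearMap_le _
  set F' : Lp 𝕜 2 μ := (hF.memLp μ 2).toLp F with hF'
  have hiter : ∀ t, (K^[t] F' : Lp 𝕜 2 μ) =ᵐ[μ] fun x => F (R^[t] x) := by
    intro t
    induction t with
    | zero => exact (hF.memLp μ 2).coeFn_toLp
    | succ t ih =>
      rw [Function.iterate_succ_apply']
      have h1 : (K (K^[t] F') : Lp 𝕜 2 μ) =ᵐ[μ] (K^[t] F' : Lp 𝕜 2 μ) ∘ R :=
        Lp.coeFn_compMeasurePreserving _ hRm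
      filter_upwards [h1, hRm.quasiMeasurePreserving.ae_eq_comp ih] with x hx1 hx2
      rw [hx1, hx2, Function.comp_apply, Function.iterate_succ_apply]
  have hlim := K.tendsto_birkhoffAverage_orthogonalProjection hKn F'
  set p : Lp 𝕜 2 μ := ((K.eqLocus (1 : Lp 𝕜 2 μ →L[𝕜] Lp 𝕜 2 μ)).orthogonalProjectionOnto F' :
    Lp 𝕜 2 μ) with hp
  have hp0 : p = 0 := by
    have hfix : K p = p :=
      ((K.eqLocus (1 : Lp 𝕜 2 μ →L[𝕜] Lp 𝕜 2 μ)).orthogonalProjectionOnto F').2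
    have h1 : (K p : Lp 𝕜 2 μ) =ᵐ[μ] (p : Lp 𝕜 2 μ) ∘ R := Lp.coeFn_compMeasurePreserving _ hRm
    rw [hfix] at h1
    obtain ⟨c, hc⟩ := hR.ae_eq_const_of_ae_eq_comp_ae (Lp.aestronglyMeasurable p) h1.symm
    have h2 : inner 𝕜 p (F' - p) = 0 := by
      have : inner 𝕜 (F' - p) p = 0 := Submodule.starProjection_inner_eq_zero
        (K := (K.eqLocus (1 : Lp 𝕜 2 μ →L[𝕜] Lp 𝕜 2 μ))) F' p
        ((K.eqLocus (1 : Lp 𝕜 2 μ →L[𝕜] Lp 𝕜 2 μ)).orthogonalProjectionOnto F').2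
      rw [← inner_conj_symm, this, map_zero]
    have h3 : inner 𝕜 p F' = 0 := by
      rw [L2.inner_def]
      have : (fun x => inner 𝕜 (p x) (F' x)) =ᵐ[μ] fun x => F x * starRingEnd 𝕜 c := by
        filter_upwards [hc, (hF.memLp μ 2).coeFn_toLp] with x hx1 hx2
        rw [hx1, hx2, Function.const_apply, RCLike.inner_apply]
      rw [integral_congr_ae this, integral_mul_const, hF0, zero_mul]
    rw [inner_sub_right, h3, zero_sub, neg_eq_zero, inner_self_eq_zero] at h2
    exact h2
  rw [hp0] at hlim
  have hsq := (hlim.norm).pow 2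
  rw [norm_zero, zero_pow two_ne_zero] at hsq
  refine hsq.congr fun H => ?_
  have hae : (birkhoffAverage 𝕜 K _root_.id H F' : Lp 𝕜 2 μ) =ᵐ[μ]
      fun x => (H : 𝕜)⁻¹ * ∑ t ∈ Finset.range H, F (R^[t] x) := by
    have h1 : ∀ H : ℕ, (birkhoffSum K _root_.id H F' : Lp 𝕜 2 μ) =ᵐ[μ]
        fun x => ∑ t ∈ Finset.range H, F (R^[t] x) := by
      intro H
      induction H with
      | zero =>
        rw [birkhoffSum_zero]
        exact Eventually.of_forall fun x => by simp
      | succ H ih =>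
        rw [birkhoffSum_succ]
        filter_upwards [ih, hiter H, Lp.coeFn_add (birkhoffSum K _root_.id H F') (K^[H] F')]
          with x hx1 hx2 hx3
        rw [Finset.sum_range_succ, ← hx1, ← hx2]
        exact hx3
    filter_upwards [h1 H, Lp.coeFn_smul (H : 𝕜)⁻¹ (birkhoffSum K _root_.id H F')] with x hx1 hx2
    rw [birkhoffAverage, hx2, Pi.smul_apply, hx1, smul_eq_mul]
  rw [← inner_self_eq_norm_sq (𝕜 := 𝕜), L2.inner_def, integral_congr_ae
    (g := fun x => ((‖(H : 𝕜)⁻¹ * ∑ t ∈ Finset.range H, F (R^[t] x)‖ ^ 2 : ℝ) : 𝕜)),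
    integral_ofReal, RCLike.ofReal_re]
  filter_upwards [hae] with x hx
  rw [hx, inner_self_eq_norm_sq_to_K, RCLike.ofReal_pow]

/-- Correlations of a function of mean zero along a weakly mixing map vanish on average. The square
of a correlation along `S` is a correlation of `(x, y) ↦ f x * conj (f y)` along `S × S`, so the
mean ergodic theorem for `S × S` applies. -/
lemma WeaklyMixing.tendsto_average_correlation {S : X → X} (hS : MeasurePreserving S μ μ)
    (hwm : WeaklyMixing S μ) {f : X → 𝕜} (hf : BddMeasurable f) (hf0 : ∫ x, f x ∂μ = 0) :
    Tendsto (fun H : ℕ => (H : ℝ)⁻¹ ^ 2 * ∑ t ∈ Finset.range H, ∑ t' ∈ Finset.range H,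
      ‖∫ x, f (S^[t] x) * starRingEnd 𝕜 (f (S^[t'] x)) ∂μ‖) atTop (𝓝 0) := by
  set F : X × X → 𝕜 := fun z => f z.1 * starRingEnd 𝕜 (f z.2) with hF
  have hFb : BddMeasurable F := (hf.comp measurable_fst).mul (hf.conj.comp measurable_snd)
  have hF0 : ∫ z, F z ∂(μ.prod μ) = 0 := by
    rw [hF, integral_prod_mul f (fun y => starRingEnd 𝕜 (f y)), hf0, zero_mul]
  have hlim := (tendsto_ergodic_average hwm hFb hF0).sqrt
  rw [Real.sqrt_zero] at hlim
  refine squeeze_zero (fun H => by positivity) (fun H => ?_) hlim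
  refine Real.le_sqrt_of_sq_le ?_
  set ρ : ℕ → ℕ → 𝕜 := fun t t' => ∫ x, f (S^[t] x) * starRingEnd 𝕜 (f (S^[t'] x)) ∂μ with hρ
  have hfS : ∀ t, BddMeasurable fun x => f (S^[t] x) := fun t => hf.comp (hS.measurable.iterate t)
  have hFS : ∀ t, BddMeasurable fun z => F ((Prod.map S S)^[t] z) :=
    fun t => hFb.comp (hwm.measurable.iterate t)
  have hcorr : ∀ t t', ∫ z, F ((Prod.map S S)^[t] z) *
      starRingEnd 𝕜 (F ((Prod.map S S)^[t'] z)) ∂(μ.prod μ) = ((‖ρ t t'‖ ^ 2 : ℝ) : 𝕜) := by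
    intro t t'
    have h1 : ∀ z, F ((Prod.map S S)^[t] z) * starRingEnd 𝕜 (F ((Prod.map S S)^[t'] z)) =
        (f (S^[t] z.1) * starRingEnd 𝕜 (f (S^[t'] z.1))) *
        starRingEnd 𝕜 (f (S^[t] z.2) * starRingEnd 𝕜 (f (S^[t'] z.2))) := by
      intro z
      simp only [hF, Prod.map_iterate, Prod.map_fst, Prod.map_snd, map_mul, RCLike.conj_conj]
      ring
    simp only [h1]
    rw [integral_prod_mul (fun x => f (S^[t] x) * starRingEnd 𝕜 (f (S^[t'] x)))
      (fun y => starRingEnd 𝕜 (f (S^[t] y) * starRingEnd 𝕜 (f (S^[t'] y)))), integral_conj,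
      RCLike.mul_conj, RCLike.ofReal_pow]
  have hexp : ∫ z, ‖(H : 𝕜)⁻¹ * ∑ t ∈ Finset.range H, F ((Prod.map S S)^[t] z)‖ ^ 2 ∂(μ.prod μ)
      = (H : ℝ)⁻¹ ^ 2 * ∑ t ∈ Finset.range H, ∑ t' ∈ Finset.range H, ‖ρ t t'‖ ^ 2 := by
    simp only [norm_mul, norm_inv, RCLike.norm_natCast, mul_pow, norm_sum_sq_eq]
    have hi := fun t t' => ((hFS t).mul (hFS t').conj)
    rw [integral_const_mul, integral_finsetSum]
    · congr 1
      refine Finset.sum_congr rfl fun t _ => ?_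
      rw [integral_finsetSum]
      · refine Finset.sum_congr rfl fun t' _ => ?_
        rw [integral_re ((hi t t').integrable _), hcorr, RCLike.ofReal_re]
      · exact fun t' _ => (hi t t').re.integrable _
    · exact fun t _ => (BddMeasurable.sum _ fun t' _ => (hi t t').re).integrable _
  rw [hexp, ← Finset.sum_product', ← Finset.sum_product']
  have hcs := sq_sum_le_card_mul_sum_sq (s := Finset.range H ×ˢ Finset.range H)
    (f := fun z => ‖ρ z.1 z.2‖)
  rw [Finset.card_product, Finset.card_range] at hcs
  rcases Nat.eq_zero_or_pos H with rfl | hH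
  · simp
  have hH' : (0 : ℝ) < H := by exact_mod_cast hH
  rw [mul_pow]
  calc _ ≤ ((H : ℝ)⁻¹ ^ 2) ^ 2 * (((H * H : ℕ) : ℝ) *
        ∑ z ∈ Finset.range H ×ˢ Finset.range H, ‖ρ z.1 z.2‖ ^ 2) := by gcongr
    _ = _ := by push_cast; field_simp

end WeakMixing

/-! ### Averages along polynomial families -/

section Families

variable {𝕜 A B X ι : Type*} [RCLike 𝕜] [AddCommGroup A] [AddCommGroup B] [AddAction (A × B) X]

/-- The product `∏ i ∈ s, φᵢ(n) ψᵢ(N) fᵢ`. The values of `φᵢ` and `ψᵢ` lie in two commuting groups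
`A` and `B` of transformations of `X`, presented as an action of `A × B`. -/
def familyProd (s : Finset ι) (φ : ι → ℤ → A) (ψ : ι → ℕ → B) (f : ι → X → 𝕜) (N : ℕ) (n : ℤ)
    (x : X) : 𝕜 :=
  ∏ i ∈ s, f i ((φ i n, ψ i N) +ᵥ x)

/-- The average of `familyProd` over `1 ≤ n ≤ N`. -/
def familyAverage (s : Finset ι) (φ : ι → ℤ → A) (ψ : ι → ℕ → B) (f : ι → X → 𝕜) (N : ℕ)
    (x : X) : 𝕜 :=
  (N : 𝕜)⁻¹ * ∑ n ∈ Finset.Icc 1 N, familyProd s φ ψ f N n x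

/-- The averages of the family converge in `L²` to the product of the integrals. -/
def ConvergesToProduct [MeasurableSpace X] (μ : Measure X) (s : Finset ι) (φ : ι → ℤ → A)
    (ψ : ι → ℕ → B) (f : ι → X → 𝕜) : Prop :=
  Tendsto (fun N => ∫ x, ‖familyAverage s φ ψ f N x - ∏ i ∈ s, ∫ y, f i y ∂μ‖ ^ 2 ∂μ) atTop (𝓝 0)

/-- A finite family of polynomial sequences of degree less than `D`, none of which is constant and
no two of which differ by a constant. -/
structure Admissible (D : ℕ) (s : Finset ι) (φ : ι → ℤ → A) : Prop where
  degree : ∀ i ∈ s, iterDiff D (φ i) = 0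
  nonconst : ∀ i ∈ s, iterDiff 1 (φ i) ≠ 0
  distinct : ∀ i ∈ s, ∀ j ∈ s, i ≠ j → iterDiff 1 (fun n => φ i n - φ j n) ≠ 0

lemma familyProd_eq_mul_erase [DecidableEq ι] {s : Finset ι} {q : ι} (hq : q ∈ s)
    (φ : ι → ℤ → A) (ψ : ι → ℕ → B) (f : ι → X → 𝕜) (N : ℕ) (n : ℤ) (x : X) :
    familyProd s φ ψ f N n x =
      f q ((φ q n, ψ q N) +ᵥ x) * familyProd (s.erase q) φ ψ f N n x :=
  (Finset.mul_prod_erase s _ hq).symm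

lemma familyProd_congr {s : Finset ι} {φ : ι → ℤ → A} {ψ : ι → ℕ → B} {f g : ι → X → 𝕜}
    (h : ∀ i ∈ s, f i = g i) (N : ℕ) (n : ℤ) (x : X) :
    familyProd s φ ψ f N n x = familyProd s φ ψ g N n x :=
  Finset.prod_congr rfl fun i hi => by rw [h i hi]

lemma norm_familyProd_le_one {s : Finset ι} {f : ι → X → 𝕜} (hf1 : ∀ i ∈ s, ∀ x, ‖f i x‖ ≤ 1)
    (φ : ι → ℤ → A) (ψ : ι → ℕ → B) (N : ℕ) (n : ℤ) (x : X) : ‖familyProd s φ ψ f N n x‖ ≤ 1 := by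
  rw [familyProd, norm_prod]
  exact Finset.prod_le_one (fun _ _ => norm_nonneg _) fun i hi => hf1 i hi _

lemma familyAverage_const_mul {s : Finset ι} (φ : ι → ℤ → A) (ψ : ι → ℕ → B) (f : ι → X → 𝕜)
    (c : 𝕜) (N : ℕ) (x : X) :
    familyAverage s φ ψ (fun i x => c * f i x) N x = c ^ s.card * familyAverage s φ ψ f N x := by
  simp only [familyAverage, familyProd, Finset.prod_mul_distrib, Finset.prod_const,
    ← Finset.mul_sum]
  ring

lemma iterate_vadd (a : A) (t : ℕ) (x : X) :
    (fun x : X => (a, (0 : B)) +ᵥ x)^[t] x = (t • a, (0 : B)) +ᵥ x := by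
  induction t with
  | zero => simp [← Prod.zero_eq_mk]
  | succ t ih =>
    rw [Function.iterate_succ_apply', ih, vadd_vadd, Prod.mk_add_mk, add_zero, succ_nsmul']

section Measure

variable [MeasurableSpace X] {μ : Measure X}

lemma bddMeasurable_familyProd (hmp : ∀ c : A × B, MeasurePreserving (fun x : X => c +ᵥ x) μ μ)
    {s : Finset ι} {φ : ι → ℤ → A} {ψ : ι → ℕ → B} {f : ι → X → 𝕜}
    (hf : ∀ i, BddMeasurable (f i)) (N : ℕ) (n : ℤ) : BddMeasurable (familyProd s φ ψ f N n) :=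
  BddMeasurable.prod s fun i _ => (hf i).comp (hmp _).measurable

lemma bddMeasurable_familyAverage (hmp : ∀ c : A × B, MeasurePreserving (fun x : X => c +ᵥ x) μ μ)
    {s : Finset ι} {φ : ι → ℤ → A} {ψ : ι → ℕ → B} {f : ι → X → 𝕜}
    (hf : ∀ i, BddMeasurable (f i)) (N : ℕ) : BddMeasurable (familyAverage s φ ψ f N) :=
  (BddMeasurable.const _).mul (BddMeasurable.sum _ fun _ _ => bddMeasurable_familyProd hmp hf N _)

variable [IsProbabilityMeasure μ]

/-- Dividing a family by its member `q`, via an invariant change of variables, reduces the averages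
of the integrals of the products to `L²` convergence for the family of differences. -/
lemma tendsto_average_integral_familyProd [DecidableEq ι]
    (hmp : ∀ c : A × B, MeasurePreserving (fun x : X => c +ᵥ x) μ μ)
    {t : Finset ι} {Φ : ι → ℤ → A} {Ψ : ι → ℕ → B} {g : ι → X → 𝕜}
    (hg : ∀ i, BddMeasurable (g i)) {q : ι} (hq : q ∈ t)
    (hconv : ConvergesToProduct μ (t.erase q) (fun p n => Φ p n - Φ q n)
      (fun p N => Ψ p N - Ψ q N) g) :
    Tendsto (fun N : ℕ => (N : 𝕜)⁻¹ * ∑ n ∈ Finset.Icc 1 N, ∫ x, familyProd t Φ Ψ g N n x ∂μ)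
      atTop (𝓝 (∏ p ∈ t, ∫ x, g p x ∂μ)) := by
  set φ' : ι → ℤ → A := fun p n => Φ p n - Φ q n with hφ'
  set ψ' : ι → ℕ → B := fun p N => Ψ p N - Ψ q N with hψ'
  set c : 𝕜 := ∏ p ∈ t.erase q, ∫ x, g p x ∂μ with hc
  have hshift : ∀ (N : ℕ) (n : ℤ), ∫ x, familyProd t Φ Ψ g N n x ∂μ =
      ∫ x, g q x * familyProd (t.erase q) φ' ψ' g N n x ∂μ := by
    intro N n
    rw [← (bddMeasurable_familyProd hmp hg N n).integral_comp (hmp (-(Φ q n, Ψ q N)))]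
    refine integral_congr_ae (Eventually.of_forall fun x => ?_)
    simp only [familyProd_eq_mul_erase hq]
    congr 1
    · rw [vadd_vadd, add_neg_cancel, zero_vadd]
    · refine Finset.prod_congr rfl fun p _ => ?_
      rw [vadd_vadd, ← sub_eq_add_neg]
      rfl
  have havg : ∀ N : ℕ, (N : 𝕜)⁻¹ * ∑ n ∈ Finset.Icc 1 N, ∫ x, familyProd t Φ Ψ g N n x ∂μ =
      ∫ x, g q x * familyAverage (t.erase q) φ' ψ' g N x ∂μ := by
    intro N
    simp only [hshift]
    rw [← integral_finsetSum _ fun (n : ℕ) _ =>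
      ((hg q).mul (bddMeasurable_familyProd hmp hg N n)).integrable μ, ← integral_const_mul]
    congr 1
    funext x
    rw [familyAverage, ← Finset.mul_sum]
    ring
  obtain ⟨C, hC⟩ := (hg q).bdd
  have hbd : ∀ N, BddMeasurable fun x => familyAverage (t.erase q) φ' ψ' g N x - c :=
    fun N => (bddMeasurable_familyAverage hmp hg N).sub (BddMeasurable.const c)
  rw [tendsto_iff_norm_sub_tendsto_zero]
  have hlim : Tendsto (fun N => C ^ 2 *
      ∫ x, ‖familyAverage (t.erase q) φ' ψ' g N x - c‖ ^ 2 ∂μ) atTop (𝓝 0) := by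
    simpa using hconv.const_mul (C ^ 2)
  have hlim' := hlim.sqrt
  rw [Real.sqrt_zero] at hlim'
  refine squeeze_zero (fun _ => norm_nonneg _) (fun N => Real.le_sqrt_of_sq_le ?_) hlim'
  have hdiff : (N : 𝕜)⁻¹ * ∑ n ∈ Finset.Icc 1 N, ∫ x, familyProd t Φ Ψ g N n x ∂μ -
      ∏ p ∈ t, ∫ x, g p x ∂μ = ∫ x, g q x * (familyAverage (t.erase q) φ' ψ' g N x - c) ∂μ := by
    rw [havg, ← Finset.mul_prod_erase t _ hq]
    simp only [mul_sub]
    rw [integral_sub (((hg q).mul (bddMeasurable_familyAverage hmp hg N)).integrable μ)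
      (((hg q).mul (BddMeasurable.const c)).integrable μ), integral_mul_const]
  rw [hdiff, ← integral_const_mul]
  refine (((hg q).mul (hbd N)).norm_integral_sq_le μ).trans ?_
  refine integral_mono (((hg q).mul (hbd N)).norm_sq.integrable μ)
    (((hbd N).norm_sq.integrable μ).const_mul _) fun x => ?_
  simp only [norm_mul, mul_pow]
  gcongr
  exact hC x

end Measure

/-- The family of translates occurring in the correlation of `familyProd` at `n + h` and `n + h'`:
`(i, true)` stands for `φ i (n + h)` and `(i, false)` for `φ i (n + h')`. For `φ i` of degree one
the two translates differ by a constant, and only `(i, true)` is kept. -/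
noncomputable def correlationIndex (s : Finset ι) (φ : ι → ℤ → A) : Finset (ι × Bool) :=
  open scoped Classical in
  (s ×ˢ Finset.univ).filter fun p => p.2 = true ∨ iterDiff 2 (φ p.1) ≠ 0

open scoped Classical in
/-- The functions belonging to `correlationIndex`. In degree one, `φ i (n + h')` is `φ i (n + h)`
plus `(h' - h) • (φ i 1 - φ i 0)`, and the two functions are merged into one. -/
noncomputable def correlationFun (φ : ι → ℤ → A) (f : ι → X → 𝕜) (h h' : ℤ) (p : ι × Bool)
    (x : X) : 𝕜 :=
  if p.2 = true then
    if iterDiff 2 (φ p.1) = 0 then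
      f p.1 x * starRingEnd 𝕜 (f p.1 (((h' - h) • (φ p.1 1 - φ p.1 0), (0 : B)) +ᵥ x))
    else f p.1 x
  else starRingEnd 𝕜 (f p.1 x)

lemma mem_correlationIndex {s : Finset ι} {φ : ι → ℤ → A} {p : ι × Bool} :
    p ∈ correlationIndex s φ ↔ p.1 ∈ s ∧ (p.2 = true ∨ iterDiff 2 (φ p.1) ≠ 0) := by
  simp [correlationIndex]

lemma familyProd_mul_conj (s : Finset ι) (φ : ι → ℤ → A) (ψ : ι → ℕ → B) (f : ι → X → 𝕜)
    (h h' : ℤ) (N : ℕ) (n : ℤ) (x : X) :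
    familyProd s φ ψ f N (n + h) x * starRingEnd 𝕜 (familyProd s φ ψ f N (n + h') x) =
      familyProd (correlationIndex s φ) (fun p n => φ p.1 (n + cond p.2 h h')) (fun p => ψ p.1)
        (correlationFun (B := B) φ f h h') N n x := by
  classical
  simp only [familyProd, map_prod, ← Finset.prod_mul_distrib]
  rw [correlationIndex, Finset.prod_filter, Finset.prod_product]
  refine Finset.prod_congr rfl fun i _ => ?_
  rw [Fintype.prod_bool]
  by_cases hlin : iterDiff 2 (φ i) = 0
  · simp only [correlationFun, hlin, if_true, cond_true, ne_eq, not_true, or_false,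
      Bool.false_eq_true, if_false, mul_one, vadd_vadd, Prod.mk_add_mk, zero_add]
    rw [show n + h' = n + h + (h' - h) by ring, linear_apply_add hlin (n + h),
      add_comm (φ i (n + h))]
  · simp [correlationFun, hlin]

lemma bddMeasurable_correlationFun [MeasurableSpace X] {μ : Measure X}
    (hmp : ∀ c : A × B, MeasurePreserving (fun x : X => c +ᵥ x) μ μ) {φ : ι → ℤ → A}
    {f : ι → X → 𝕜} (hf : ∀ i, BddMeasurable (f i)) (h h' : ℤ) (p : ι × Bool) :
    BddMeasurable (correlationFun (B := B) φ f h h' p) := by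
  unfold correlationFun
  split_ifs
  · exact (hf _).mul ((hf _).conj.comp (hmp _).measurable)
  · exact hf _
  · exact (hf _).conj

lemma norm_correlationFun_le_one {φ : ι → ℤ → A} {f : ι → X → 𝕜} (h h' : ℤ) {p : ι × Bool}
    (hf1 : ∀ x, ‖f p.1 x‖ ≤ 1) (x : X) : ‖correlationFun (B := B) φ f h h' p x‖ ≤ 1 := by
  unfold correlationFun
  split_ifs
  · rw [norm_mul, RCLike.norm_conj]
    exact mul_le_one₀ (hf1 _) (norm_nonneg _) (hf1 _)
  · exact hf1 _
  · rw [RCLike.norm_conj]; exact hf1 _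

/-- If `M` is a spacing for the family as in `exists_spacing`, and `φ q` has minimal degree, then
dividing the correlation family by a translate of `φ q` gives an admissible family. -/
lemma Admissible.correlation [IsAddTorsionFree A] [DecidableEq ι] {D : ℕ} {s : Finset ι}
    {φ : ι → ℤ → A} (hadm : Admissible D s φ) {h h' : ℤ} (hh : h ≠ h')
    (hsp : ∀ i ∈ s, ∀ j ∈ s, i ≠ j → ∀ e ∈ ({h, h'} : Set ℤ), ∀ e' ∈ ({h, h'} : Set ℤ), e ≠ e' →
      iterDiff 1 (fun n => φ i (n + e) - φ j (n + e')) ≠ 0) {q : ι} (hq : q ∈ s) :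
    Admissible D ((correlationIndex s φ).erase (q, true))
      (fun p n => φ p.1 (n + cond p.2 h h') - φ q (n + h)) := by
  have key : ∀ p ∈ correlationIndex s φ, ∀ r ∈ correlationIndex s φ, p ≠ r →
      iterDiff 1 (fun n => φ p.1 (n + cond p.2 h h') - φ r.1 (n + cond r.2 h h')) ≠ 0 := by
    rintro ⟨i, b⟩ hp ⟨j, b'⟩ hr hpr
    rw [mem_correlationIndex] at hp hr
    by_cases hij : i = j
    · subst hij
      have hnl : iterDiff 2 (φ i) ≠ 0 := by
        rcases hp.2 with hb | hb
        · rcases hr.2 with hb' | hb'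
          · exact absurd (by rw [show b = true from hb, show b' = true from hb']) hpr
          · exact hb'
        · exact hb
      refine iterDiff_one_shift_sub_ne_zero ⟨D, hadm.degree i hp.1⟩ hnl ?_
      cases b <;> cases b' <;> simp_all [eq_comm]
    · by_cases hb : b = b'
      · subst hb
        have := hadm.distinct i hp.1 j hr.1 hij
        rwa [ne_eq, ← iterDiff_shift_eq_zero_iff 1 _ (cond b h h')] at this
      · refine hsp i hp.1 j hr.1 hij _ ?_ _ ?_ ?_
        · cases b <;> simp
        · cases b' <;> simp
        · cases b <;> cases b' <;> simp_all [eq_comm]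
  have hqm : (q, true) ∈ correlationIndex s φ := mem_correlationIndex.2 ⟨hq, Or.inl rfl⟩
  refine ⟨fun p hp => ?_, fun p hp => ?_, fun p hp r hr hpr H => ?_⟩
  · have hp' := (mem_correlationIndex.1 (Finset.mem_of_mem_erase hp)).1
    funext n
    rw [iterDiff_sub_apply, iterDiff_shift_apply, iterDiff_shift_apply, hadm.degree _ hp',
      hadm.degree _ hq]
    simp
  · exact key p (Finset.mem_of_mem_erase hp) (q, true) hqm (Finset.ne_of_mem_erase hp)
  · refine key p (Finset.mem_of_mem_erase hp) r (Finset.mem_of_mem_erase hr) hpr ?_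
    rw [← H]
    congr 1
    funext n
    abel

end Families

/-! ### The induction on the weight -/

section Induction

variable {𝕜 A B X ι : Type*} [RCLike 𝕜] [AddCommGroup A] [AddCommGroup B] [AddAction (A × B) X]
  [MeasurableSpace X] {μ : Measure X} [IsProbabilityMeasure μ]

/-- The integral of van der Corput's inequality. Diagonal terms are bounded by one. -/
lemma integral_vanDerCorput {u : ℤ → X → 𝕜} (hu : ∀ n, BddMeasurable (u n))
    (hu1 : ∀ n x, ‖u n x‖ ≤ 1) {H N : ℕ} (M : ℕ) (hH : 0 < H) (hN : 0 < N) :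
    ∫ x, ‖(N : 𝕜)⁻¹ * ∑ n ∈ Finset.Icc 1 N, u n x‖ ^ 2 ∂μ ≤
      2 * ((H : ℝ)⁻¹ ^ 2 * ∑ t ∈ Finset.range H, ∑ t' ∈ Finset.range H,
        if t = t' then 1 else ‖(N : 𝕜)⁻¹ * ∑ n ∈ Finset.Icc 1 N,
          ∫ x, u (n + t * M) x * starRingEnd 𝕜 (u (n + t' * M) x) ∂μ‖)
      + 8 * (H * M / N) ^ 2 := by
  have hprod : ∀ m m' : ℤ, BddMeasurable fun x => u m x * starRingEnd 𝕜 (u m' x) :=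
    fun m m' => (hu m).mul (hu m').conj
  have hsum : ∀ t t' : ℕ, BddMeasurable fun x => (N : ℝ)⁻¹ * ∑ n ∈ Finset.Icc 1 N,
      RCLike.re (u (n + t * M) x * starRingEnd 𝕜 (u (n + t' * M) x)) := fun t t' =>
    (BddMeasurable.const (𝕜 := ℝ) _).mul (BddMeasurable.sum _ fun _ _ => (hprod _ _).re)
  have hsum2 : ∀ t : ℕ, BddMeasurable fun x => ∑ t' ∈ Finset.range H, (N : ℝ)⁻¹ *
      ∑ n ∈ Finset.Icc 1 N, RCLike.re (u (n + t * M) x * starRingEnd 𝕜 (u (n + t' * M) x)) :=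
    fun t => BddMeasurable.sum _ fun t' _ => hsum t t'
  have hsum3 : BddMeasurable fun x => 2 * ((H : ℝ)⁻¹ ^ 2 * ∑ t ∈ Finset.range H,
      ∑ t' ∈ Finset.range H, (N : ℝ)⁻¹ * ∑ n ∈ Finset.Icc 1 N,
        RCLike.re (u (n + t * M) x * starRingEnd 𝕜 (u (n + t' * M) x))) :=
    (BddMeasurable.const (𝕜 := ℝ) _).mul ((BddMeasurable.const (𝕜 := ℝ) _).mul
      (BddMeasurable.sum _ fun t _ => hsum2 t))
  have hmono : ∫ x, ‖(N : 𝕜)⁻¹ * ∑ n ∈ Finset.Icc 1 N, u n x‖ ^ 2 ∂μ ≤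
      ∫ x, (2 * ((H : ℝ)⁻¹ ^ 2 * ∑ t ∈ Finset.range H,
      ∑ t' ∈ Finset.range H, (N : ℝ)⁻¹ * ∑ n ∈ Finset.Icc 1 N,
        RCLike.re (u (n + t * M) x * starRingEnd 𝕜 (u (n + t' * M) x)))
        + 8 * ((H : ℝ) * M / N) ^ 2) ∂μ := by
    have h1 : BddMeasurable fun x => (N : 𝕜)⁻¹ * ∑ n ∈ Finset.Icc 1 N, u n x :=
      (BddMeasurable.const _).mul (BddMeasurable.sum _ fun n _ => hu n)
    refine integral_mono (h1.norm_sq.integrable μ)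
      ((hsum3.add (BddMeasurable.const (𝕜 := ℝ) _)).integrable μ) fun x => ?_
    exact vanDerCorput (fun n => u n x) (fun n => hu1 n x) M hH hN
  refine hmono.trans ?_
  rw [integral_add (hsum3.integrable μ) (integrable_const _), integral_const_mul,
    integral_const_mul, integral_finsetSum _ fun t _ => (hsum2 t).integrable μ, integral_const,
    probReal_univ, one_smul]
  gcongr with t ht
  rw [integral_finsetSum _ fun t' _ => (hsum t t').integrable μ]
  refine Finset.sum_le_sum fun t' _ => ?_
  have hre : ∫ x, (N : ℝ)⁻¹ * ∑ n ∈ Finset.Icc 1 N,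
      RCLike.re (u (n + t * M) x * starRingEnd 𝕜 (u (n + t' * M) x)) ∂μ =
      (N : ℝ)⁻¹ * ∑ n ∈ Finset.Icc 1 N,
        RCLike.re (∫ x, u (n + t * M) x * starRingEnd 𝕜 (u (n + t' * M) x) ∂μ) := by
    rw [integral_const_mul, integral_finsetSum _ fun n _ => (hprod _ _).re.integrable μ]
    congr 1
    exact Finset.sum_congr rfl fun n _ => integral_re ((hprod _ _).integrable μ)
  have hreal : ∀ z : ℕ → 𝕜, (N : ℝ)⁻¹ * ∑ n ∈ Finset.Icc 1 N, RCLike.re (z n) =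
      RCLike.re ((N : 𝕜)⁻¹ * ∑ n ∈ Finset.Icc 1 N, z n) := by
    intro z
    rw [← map_sum, ← RCLike.re_ofReal_mul]
    push_cast
    rfl
  rw [hre]
  split_ifs with htt
  · have h1 : ∀ n ∈ Finset.Icc 1 N,
        RCLike.re (∫ x, u (n + t * M) x * starRingEnd 𝕜 (u (n + t' * M) x) ∂μ) ≤ 1 := by
      intro n _
      refine (RCLike.re_le_norm _).trans ?_
      refine (norm_integral_le_of_norm_le_const (C := 1) (Eventually.of_forall fun x => ?_)).trans
        (by simp)
      rw [norm_mul, RCLike.norm_conj]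
      exact mul_le_one₀ (hu1 _ _) (norm_nonneg _) (hu1 _ _)
    have h2 := Finset.sum_le_sum h1
    rw [Finset.sum_const, Nat.card_Icc, Nat.add_sub_cancel, nsmul_eq_mul, mul_one] at h2
    have hN' : (0 : ℝ) < N := by exact_mod_cast hN
    calc _ ≤ (N : ℝ)⁻¹ * N := by gcongr
      _ = 1 := inv_mul_cancel₀ hN'.ne'
  · rw [hreal fun n : ℕ => ∫ x, u (n + t * M) x * starRingEnd 𝕜 (u (n + t' * M) x) ∂μ]
    exact RCLike.re_le_norm _

/-- The integrals of the correlation functions of a member of mean zero are small on average over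
the shifts: they vanish in degree at least two, and in degree one this is weak mixing. -/
lemma tendsto_average_integral_correlationFun [IsAddTorsionFree A]
    (hmp : ∀ c : A × B, MeasurePreserving (fun x : X => c +ᵥ x) μ μ)
    (hwm : ∀ a : A, a ≠ 0 → WeaklyMixing (fun x : X => (a, (0 : B)) +ᵥ x) μ)
    {φ : ι → ℤ → A} {f : ι → X → 𝕜} (hf : ∀ i, BddMeasurable (f i)) {i : ι}
    (hne : iterDiff 1 (φ i) ≠ 0) (hi : ∫ x, f i x ∂μ = 0) {M : ℕ} (hM : 0 < M) :
    Tendsto (fun H : ℕ => (H : ℝ)⁻¹ ^ 2 * ∑ t ∈ Finset.range H, ∑ t' ∈ Finset.range H,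
      ‖∫ x, correlationFun (B := B) φ f (t * M) (t' * M) (i, true) x ∂μ‖) atTop (𝓝 0) := by
  by_cases hlin : iterDiff 2 (φ i) = 0
  · set a : A := M • (φ i 1 - φ i 0) with ha
    have ha0 : a ≠ 0 := by
      intro h0
      rcases (smul_eq_zero (R := ℕ) (M := A)).1 h0 with h1 | h1
      · omega
      · refine hne (iterDiff_one_eq_zero_iff.2 ⟨φ i 0, fun n => ?_⟩)
        have := linear_apply_add hlin 0 n
        rwa [h1, smul_zero, add_zero, zero_add] at this
    refine ((hwm a ha0).tendsto_average_correlation (hmp _) (hf i) hi).congr fun H => ?_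
    refine congrArg _ (Finset.sum_congr rfl fun t _ => Finset.sum_congr rfl fun t' _ => ?_)
    congr 1
    have hb := bddMeasurable_correlationFun (B := B) hmp (φ := φ) hf (t * M) (t' * M) (i, true)
    rw [← hb.integral_comp (hmp (t • a, 0))]
    congr 1
    funext x
    simp only [correlationFun, hlin, if_true, iterate_vadd, vadd_vadd, Prod.mk_add_mk, add_zero]
    congr 5
    rw [ha, ← natCast_zsmul, ← natCast_zsmul, ← natCast_zsmul, smul_smul, smul_smul, ← add_smul]
    congr 1
    ring
  · simp [correlationFun, hlin, hi]

/-- The inductive step when one of the functions has mean zero and all are bounded by one: given the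
conclusion for all admissible families of smaller weight, the averages tend to zero in `L²`. -/
lemma tendsto_familyAverage_of_integral_eq_zero [IsAddTorsionFree A]
    (hmp : ∀ c : A × B, MeasurePreserving (fun x : X => c +ᵥ x) μ μ)
    (hwm : ∀ a : A, a ≠ 0 → WeaklyMixing (fun x : X => (a, (0 : B)) +ᵥ x) μ)
    {D : ℕ} {s : Finset ι} {φ : ι → ℤ → A} (hadm : Admissible D s φ)
    (IH : ∀ (t : Finset (ι × Bool)) (φ' : ι × Bool → ℤ → A) (ψ' : ι × Bool → ℕ → B)
      (g : ι × Bool → X → 𝕜), polyWeight D t φ' < polyWeight D s φ → Admissible D t φ' →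
      (∀ p, BddMeasurable (g p)) → ConvergesToProduct μ t φ' ψ' g)
    (ψ : ι → ℕ → B) {f : ι → X → 𝕜} (hf : ∀ i, BddMeasurable (f i))
    (hf1 : ∀ i ∈ s, ∀ x, ‖f i x‖ ≤ 1) {i₀ : ι} (hi₀ : i₀ ∈ s) (hzero : ∫ x, f i₀ x ∂μ = 0) :
    Tendsto (fun N => ∫ x, ‖familyAverage s φ ψ f N x‖ ^ 2 ∂μ) atTop (𝓝 0) := by
  classical
  obtain ⟨m, _, hmD, hdeg, q, hq, hq0⟩ :=
    exists_minimal_degree ⟨i₀, hi₀⟩ hadm.degree hadm.nonconst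
  obtain ⟨M, hM, hsp⟩ := exists_spacing s φ (fun i hi => ⟨D, hadm.degree i hi⟩) hadm.distinct
  -- The limits of the correlations for distinct shifts.
  have hcorr : ∀ t t' : ℕ, t ≠ t' → Tendsto (fun N : ℕ => (N : 𝕜)⁻¹ * ∑ n ∈ Finset.Icc 1 N,
      ∫ x, familyProd s φ ψ f N (n + t * M) x *
        starRingEnd 𝕜 (familyProd s φ ψ f N (n + t' * M) x) ∂μ) atTop
      (𝓝 (∏ p ∈ correlationIndex s φ,
        ∫ x, correlationFun (B := B) φ f (t * M) (t' * M) p x ∂μ)) := by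
    intro t t' htt
    simp only [familyProd_mul_conj]
    refine tendsto_average_integral_familyProd hmp
      (fun p => bddMeasurable_correlationFun hmp hf _ _ p)
      (q := (q, true)) (mem_correlationIndex.2 ⟨hq, Or.inl rfl⟩) ?_
    have hhne : (t * M : ℤ) ≠ t' * M := by
      intro h
      have hM0 : (M : ℤ) ≠ 0 := by exact_mod_cast hM.ne'
      exact htt (by exact_mod_cast mul_right_cancel₀ hM0 h)
    refine IH _ _ _ _ ?_ ?_ fun p => bddMeasurable_correlationFun hmp hf _ _ p
    · exact polyWeight_lt hmD hdeg hq hq0 (π := Prod.fst)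
        (σ := fun p => cond p.2 (t * M : ℤ) (t' * M)) (h := t * M)
        (fun p hp => (mem_correlationIndex.1 (Finset.mem_of_mem_erase hp)).1)
        fun i hi hiq => ⟨(i, true), Finset.mem_erase.2
          ⟨fun h => hiq (congrArg Prod.fst h), mem_correlationIndex.2 ⟨hi, Or.inl rfl⟩⟩, rfl⟩
    · refine hadm.correlation hhne (fun i hi j hj hij e he e' he' hee => ?_) hq
      have hform : ∀ e ∈ ({(t * M : ℤ), (t' * M : ℤ)} : Set ℤ), ∃ k : ℤ, e = k * M := by
        rintro e (rfl | rfl)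
        exacts [⟨t, rfl⟩, ⟨t', rfl⟩]
      obtain ⟨k, rfl⟩ := hform e he
      obtain ⟨k', rfl⟩ := hform e' he'
      exact hsp i hi j hj hij k k' fun h => hee (by rw [h])
  have hle : ∀ t t' : ℕ,
      ‖∏ p ∈ correlationIndex s φ, ∫ x, correlationFun (B := B) φ f (t * M) (t' * M) p x ∂μ‖ ≤
      ‖∫ x, correlationFun (B := B) φ f (t * M) (t' * M) (i₀, true) x ∂μ‖ := by
    intro t t'
    rw [norm_prod, ← Finset.mul_prod_erase _ _
      (mem_correlationIndex.2 ⟨hi₀, Or.inl rfl⟩ : (i₀, true) ∈ correlationIndex s φ)]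
    refine mul_le_of_le_one_right (norm_nonneg _) (Finset.prod_le_one (fun _ _ => norm_nonneg _)
      fun p hp => ?_)
    have hp' := (mem_correlationIndex.1 (Finset.mem_of_mem_erase hp)).1
    exact (norm_integral_le_of_norm_le_const (C := 1) (Eventually.of_forall fun x =>
      norm_correlationFun_le_one _ _ (hf1 _ hp') x)).trans (by simp)
  have hρ := tendsto_average_integral_correlationFun hmp hwm hf (hadm.nonconst i₀ hi₀) hzero hM
  refine tendsto_order.2 ⟨fun b hb => Eventually.of_forall fun N =>
    hb.trans_le (integral_nonneg fun x => by positivity), fun ε hε => ?_⟩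
  obtain ⟨H, hHε, hH⟩ : ∃ H : ℕ, 2 * ((H : ℝ)⁻¹ + (H : ℝ)⁻¹ ^ 2 * ∑ t ∈ Finset.range H,
      ∑ t' ∈ Finset.range H,
        ‖∫ x, correlationFun (B := B) φ f (t * M) (t' * M) (i₀, true) x ∂μ‖) < ε ∧ 0 < H := by
    have h1 := ((tendsto_inv_atTop_nhds_zero_nat (𝕜 := ℝ)).add hρ).const_mul 2
    rw [add_zero, mul_zero] at h1
    exact ((h1.eventually_lt_const hε).and (eventually_gt_atTop 0)).exists
  have hlim : Tendsto (fun N : ℕ => 2 * ((H : ℝ)⁻¹ ^ 2 * ∑ t ∈ Finset.range H,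
      ∑ t' ∈ Finset.range H, if t = t' then 1 else ‖(N : 𝕜)⁻¹ * ∑ n ∈ Finset.Icc 1 N,
          ∫ x, familyProd s φ ψ f N (n + t * M) x *
            starRingEnd 𝕜 (familyProd s φ ψ f N (n + t' * M) x) ∂μ‖)
      + 8 * (H * M / N) ^ 2) atTop (𝓝 (2 * ((H : ℝ)⁻¹ ^ 2 * ∑ t ∈ Finset.range H,
        ∑ t' ∈ Finset.range H, if t = t' then 1 else
          ‖∏ p ∈ correlationIndex s φ,
            ∫ x, correlationFun (B := B) φ f (t * M) (t' * M) p x ∂μ‖) + 8 * 0 ^ 2)) := by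
    refine Tendsto.add ?_ (((tendsto_const_div_atTop_nhds_zero_nat _).pow 2).const_mul 8)
    refine (Tendsto.const_mul _ (tendsto_finsetSum _ fun t _ => tendsto_finsetSum _ fun t' _ => ?_)
      ).const_mul 2
    by_cases htt : t = t'
    · simp only [if_pos htt]; exact tendsto_const_nhds
    · simp only [if_neg htt]; exact (hcorr t t' htt).norm
  have hlt : 2 * ((H : ℝ)⁻¹ ^ 2 * ∑ t ∈ Finset.range H,
        ∑ t' ∈ Finset.range H, if t = t' then 1 else
          ‖∏ p ∈ correlationIndex s φ,
            ∫ x, correlationFun (B := B) φ f (t * M) (t' * M) p x ∂μ‖) + 8 * 0 ^ 2 < ε := by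
    refine lt_of_le_of_lt ?_ hHε
    have hH' : (0 : ℝ) < H := by exact_mod_cast hH
    have hdiag : ((H : ℝ)⁻¹ : ℝ) = (H : ℝ)⁻¹ ^ 2 * ∑ t ∈ Finset.range H, ∑ t' ∈ Finset.range H,
        if t = t' then (1 : ℝ) else 0 := by
      rw [Finset.sum_congr rfl fun t ht => by rw [Finset.sum_ite_eq, if_pos ht]]
      rw [Finset.sum_const, Finset.card_range, nsmul_eq_mul]
      field_simp
    rw [zero_pow two_ne_zero, mul_zero, add_zero]
    refine mul_le_mul_of_nonneg_left ?_ zero_le_two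
    refine le_of_le_of_eq ?_ (congrArg (· + _) hdiag.symm)
    rw [← mul_add, ← Finset.sum_add_distrib]
    refine mul_le_mul_of_nonneg_left (Finset.sum_le_sum fun t _ => ?_) (by positivity)
    rw [← Finset.sum_add_distrib]
    refine Finset.sum_le_sum fun t' _ => ?_
    split_ifs with htt
    · exact le_add_of_nonneg_right (norm_nonneg _)
    · rw [zero_add]; exact hle t t'
  filter_upwards [hlim.eventually_lt_const hlt, eventually_gt_atTop 0] with N hN hN0
  exact (integral_vanDerCorput (fun n => bddMeasurable_familyProd hmp hf N n)
    (fun n x => norm_familyProd_le_one hf1 φ ψ N n x) M hH hN0).trans_lt hN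

/-- Convergence for families with one function of mean zero implies convergence to the product of
the integrals for all families, by replacing the functions by their integrals one at a time. -/
lemma convergesToProduct_of_zero_mean
    (hmp : ∀ c : A × B, MeasurePreserving (fun x : X => c +ᵥ x) μ μ)
    {s : Finset ι} {φ : ι → ℤ → A} {ψ : ι → ℕ → B}
    (hz : ∀ f : ι → X → 𝕜, (∀ i, BddMeasurable (f i)) → (∀ i ∈ s, ∀ x, ‖f i x‖ ≤ 1) →
      ∀ i₀ ∈ s, ∫ x, f i₀ x ∂μ = 0 →
      Tendsto (fun N => ∫ x, ‖familyAverage s φ ψ f N x‖ ^ 2 ∂μ) atTop (𝓝 0))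
    {f : ι → X → 𝕜} (hf : ∀ i, BddMeasurable (f i)) : ConvergesToProduct μ s φ ψ f := by
  classical
  have hz' : ∀ f : ι → X → 𝕜, (∀ i, BddMeasurable (f i)) → ∀ i₀ ∈ s, ∫ x, f i₀ x ∂μ = 0 →
      Tendsto (fun N => ∫ x, ‖familyAverage s φ ψ f N x‖ ^ 2 ∂μ) atTop (𝓝 0) := by
    intro f hf i₀ hi₀ h0
    choose C hC using fun i => (hf i).bdd
    set K : ℝ := 1 + ∑ i ∈ s, |C i| with hK
    have hK0 : 0 < K := by positivity
    have hKk : (K : 𝕜) ≠ 0 := by exact_mod_cast hK0.ne'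
    have h1 := hz (fun i x => (K : 𝕜)⁻¹ * f i x) (fun i => (BddMeasurable.const _).mul (hf i))
      (fun i hi x => ?_) i₀ hi₀ (by rw [integral_const_mul, h0, mul_zero])
    · have h2 := h1.const_mul ((K ^ s.card) ^ 2)
      rw [mul_zero] at h2
      refine h2.congr fun N => ?_
      rw [← integral_const_mul]
      congr 1
      funext x
      rw [familyAverage_const_mul, norm_mul, norm_pow, norm_inv, RCLike.norm_ofReal,
        abs_of_pos hK0, inv_pow, mul_pow, ← mul_assoc, ← mul_pow,
        mul_inv_cancel₀ (pow_pos hK0 _).ne', one_pow, one_mul]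
    · rw [norm_mul, norm_inv, RCLike.norm_ofReal, abs_of_pos hK0, inv_mul_le_iff₀ hK0, mul_one]
      have h3 : |C i| ≤ ∑ i ∈ s, |C i| :=
        Finset.single_le_sum (f := fun i => |C i|) (fun _ _ => abs_nonneg _) hi
      linarith [hC i x, le_abs_self (C i)]
  -- `g r` has the functions indexed by `r` replaced by their integrals.
  set g : Finset ι → ι → X → 𝕜 := fun r i => if i ∈ r then fun _ => ∫ y, f i y ∂μ else f i with hg
  have hgb : ∀ r i, BddMeasurable (g r i) := by
    intro r i
    simp only [hg]
    split_ifs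
    exacts [BddMeasurable.const _, hf i]
  have main : ∀ r : Finset ι, r ⊆ s → Tendsto (fun N => ∫ x, ‖familyAverage s φ ψ f N x -
      familyAverage s φ ψ (g r) N x‖ ^ 2 ∂μ) atTop (𝓝 0) := by
    intro r
    induction r using Finset.induction_on with
    | empty => intro _; simp [hg]
    | insert a r ha ih =>
      intro hr
      have has : a ∈ s := hr (Finset.mem_insert_self a r)
      set F : ι → X → 𝕜 := Function.update (g r) a fun x => f a x - ∫ y, f a y ∂μ with hF
      have hFb : ∀ i, BddMeasurable (F i) := by
        intro i
        by_cases hi : i = a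
        · subst hi
          rw [hF, Function.update_self]
          exact (hf i).sub (BddMeasurable.const _)
        · rw [hF, Function.update_of_ne hi]; exact hgb r i
      have hF0 : ∫ x, F a x ∂μ = 0 := by
        rw [hF, Function.update_self, integral_sub ((hf a).integrable μ) (integrable_const _)]
        simp
      have hdiff : ∀ N x, familyAverage s φ ψ (g r) N x - familyAverage s φ ψ (g (insert a r)) N x
          = familyAverage s φ ψ F N x := by
        intro N x
        simp only [familyAverage]
        rw [← mul_sub, ← Finset.sum_sub_distrib]
        congr 1
        refine Finset.sum_congr rfl fun n _ => ?_
        rw [familyProd_eq_mul_erase has, familyProd_eq_mul_erase has _ _ (g (insert a r)),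
          familyProd_eq_mul_erase has _ _ F,
          familyProd_congr (g := g r) (f := g (insert a r)) fun i hi => ?_,
          familyProd_congr (g := g r) (f := F) fun i hi => ?_, ← sub_mul]
        · simp [hF, hg, ha]
        · rw [hF, Function.update_of_ne (Finset.ne_of_mem_erase hi)]
        · simp [hg, Finset.ne_of_mem_erase hi]
      have hlim := ((ih ((Finset.subset_insert a r).trans hr)).const_mul 2).add
        ((hz' F hFb a has hF0).const_mul 2)
      rw [mul_zero, add_zero] at hlim
      refine squeeze_zero (fun N => integral_nonneg fun x => by positivity) (fun N => ?_) hlim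
      have hb : ∀ {f : ι → X → 𝕜}, (∀ i, BddMeasurable (f i)) →
          BddMeasurable (familyAverage s φ ψ f N) := fun h => bddMeasurable_familyAverage hmp h N
      have hi1 := ((hb hf).sub (hb (hgb r))).norm_sq.integrable μ
      have hi2 := (hb hFb).norm_sq.integrable μ
      rw [← integral_const_mul, ← integral_const_mul,
        ← integral_add (hi1.const_mul 2) (hi2.const_mul 2)]
      refine integral_mono (((hb hf).sub (hb (hgb _))).norm_sq.integrable μ)
        ((hi1.const_mul 2).add (hi2.const_mul 2)) fun x => ?_
      simp only [← hdiff]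
      have htri := norm_add_le
        (familyAverage s φ ψ f N x - familyAverage s φ ψ (g r) N x)
        (familyAverage s φ ψ (g r) N x - familyAverage s φ ψ (g (insert a r)) N x)
      rw [sub_add_sub_cancel] at htri
      have hsq := pow_le_pow_left₀ (norm_nonneg _) htri 2
      nlinarith [sq_nonneg (‖familyAverage s φ ψ f N x - familyAverage s φ ψ (g r) N x‖ -
        ‖familyAverage s φ ψ (g r) N x - familyAverage s φ ψ (g (insert a r)) N x‖)]
  refine (main s subset_rfl).congr' ?_
  filter_upwards [eventually_gt_atTop 0] with N hN
  have hNk : (N : 𝕜) ≠ 0 := by exact_mod_cast hN.ne'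
  congr 1
  funext x
  congr 3
  have h1 : ∀ n : ℤ, familyProd s φ ψ (g s) N n x = ∏ i ∈ s, ∫ y, f i y ∂μ := fun n =>
    Finset.prod_congr rfl fun i hi => by simp [hg, hi]
  simp [familyAverage, h1, hNk]

/-- The theorem for admissible families, by induction on the weight. -/
theorem Admissible.convergesToProduct [IsAddTorsionFree A]
    (hmp : ∀ c : A × B, MeasurePreserving (fun x : X => c +ᵥ x) μ μ)
    (hwm : ∀ a : A, a ≠ 0 → WeaklyMixing (fun x : X => (a, (0 : B)) +ᵥ x) μ)
    {D : ℕ} {ι : Type} {s : Finset ι} {φ : ι → ℤ → A} (hadm : Admissible D s φ) (ψ : ι → ℕ → B)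
    {f : ι → X → 𝕜} (hf : ∀ i, BddMeasurable (f i)) : ConvergesToProduct μ s φ ψ f := by
  induction hw : polyWeight D s φ using WellFoundedLT.induction generalizing ι with
  | ind w ih =>
    subst hw
    exact convergesToProduct_of_zero_mean hmp (fun f hf hf1 i₀ hi₀ h0 =>
      tendsto_familyAverage_of_integral_eq_zero hmp hwm hadm
        (fun t φ' ψ' g hlt hadm' hg => ih _ hlt hadm' ψ' hg rfl) ψ hf hf1 hi₀ h0) hf

end Induction

/-! ### Reduction of the theorem to commuting actions of two abelian groups -/

section Translation

lemma iterDiff_map {A A' : Type*} [AddCommGroup A] [AddCommGroup A'] (F : A →+ A') (d : ℕ)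
    (φ : ℤ → A) (n : ℤ) : iterDiff d (fun n => F (φ n)) n = F (iterDiff d φ n) := by
  induction d generalizing n with
  | zero => rfl
  | succ d ih => rw [iterDiff_succ_apply, iterDiff_succ_apply, ih, ih, map_sub]

lemma iterDiff_sum_apply {A ι : Type*} [AddCommGroup A] (s : Finset ι) (d : ℕ) (φ : ι → ℤ → A)
    (n : ℤ) : iterDiff d (fun n => ∑ i ∈ s, φ i n) n = ∑ i ∈ s, iterDiff d (φ i) n := by
  induction d generalizing n with
  | zero => rfl
  | succ d ih => simp only [iterDiff_succ_apply, ih, Finset.sum_sub_distrib]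

lemma IsIntegerValuedPolynomial.exists_iterDiff_eq_zero {p : ℤ → ℤ}
    (hp : IsIntegerValuedPolynomial p) : ∃ d, iterDiff d p = 0 := by
  obtain ⟨q, hq⟩ := hp
  refine ⟨q.natDegree + 1, funext fun n => ?_⟩
  have hcast : ∀ d (n : ℤ),
      ((fwdDiff (1 : ℝ))^[d] q.eval) (n : ℝ) = ((iterDiff d p n : ℤ) : ℝ) := by
    intro d
    induction d with
    | zero => exact hq
    | succ d ih =>
      intro n
      rw [Function.iterate_succ_apply', iterDiff_succ_apply, fwdDiff, Int.cast_sub, ← ih, ← ih]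
      push_cast
      rfl
  have h := hcast (q.natDegree + 1) n
  rw [Polynomial.fwdDiff_iter_degree_add_one_eq_zero, Pi.zero_apply] at h
  rw [Pi.zero_apply]
  exact_mod_cast h.symm

lemma polyExpr_exists_iterDiff_eq_zero {G : Type*} [CommGroup G] {k : ℕ} (T : Fin k → G)
    {P : Fin k → ℤ → ℤ} (hP : ∀ j, IsIntegerValuedPolynomial (P j)) :
    ∃ d, iterDiff d (fun n => Additive.ofMul (polyExpr T P n)) = 0 := by
  choose d hd using fun j => (hP j).exists_iterDiff_eq_zero
  refine ⟨∑ j, d j, funext fun n => ?_⟩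
  have h1 : (fun n => Additive.ofMul (polyExpr T P n)) =
      fun n => ∑ j, zmultiplesHom _ (Additive.ofMul (T j)) (P j n) := by
    funext n
    simp [polyExpr, ofMul_prod, ofMul_zpow]
  rw [h1, iterDiff_sum_apply]
  refine Finset.sum_eq_zero fun j _ => ?_
  rw [iterDiff_map, iterDiff_eq_zero_of_le
    (Finset.single_le_sum (f := d) (fun _ _ => Nat.zero_le _) (Finset.mem_univ j)) (hd j)]
  exact map_zero _

/-- Two commuting actions of commutative groups, combined into one action in additive notation. -/
@[reducible] def commutingAddAction (U V X : Type*) [CommGroup U] [CommGroup V] [MulAction U X]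
    [MulAction V X] [SMulCommClass U V X] : AddAction (Additive U × Additive V) X where
  vadd c x := c.1.toMul • c.2.toMul • x
  zero_vadd x := by
    change (1 : U) • (1 : V) • x = x
    simp
  add_vadd c d x := by
    change (c.1.toMul * d.1.toMul) • (c.2.toMul * d.2.toMul) • x =
      c.1.toMul • c.2.toMul • d.1.toMul • d.2.toMul • x
    rw [mul_smul, mul_smul, ← smul_comm d.1.toMul c.2.toMul]

lemma Subgroup.closure_commute_smul {G : Type*} [Group G] {X : Type*} [MulAction G X]
    {s : Set G} {t : Set (Equiv.Perm X)} (h : ∀ σ ∈ t, ∀ g ∈ s, ∀ x, σ (g • x) = g • σ x)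
    {σ : Equiv.Perm X} (hσ : σ ∈ Subgroup.closure t) {g : G} (hg : g ∈ Subgroup.closure s)
    (x : X) : σ (g • x) = g • σ x := by
  suffices hc : Commute σ (MulAction.toPermHom G X g) from DFunLike.congr_fun hc.eq x
  induction hσ using Subgroup.closure_induction with
  | one => exact Commute.one_left _
  | mul σ τ _ _ h1 h2 => exact h1.mul_left h2
  | inv σ _ h1 => exact h1.inv_left
  | mem σ hσ =>
    induction hg using Subgroup.closure_induction with
    | one => rw [map_one]; exact Commute.one_right _
    | mul g g' _ _ h1 h2 => rw [map_mul]; exact h1.mul_right h2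
    | inv g _ h1 => rw [map_inv]; exact h1.inv_right
    | mem g hg => exact Equiv.ext fun x => h σ hσ g hg x

variable {X : Type*} [MeasurableSpace X] {μ : Measure X}

lemma InvertibleMeasurePreserving.of_mem_closure {s : Set (Equiv.Perm X)}
    (hs : ∀ σ ∈ s, InvertibleMeasurePreserving σ μ) {σ : Equiv.Perm X}
    (hσ : σ ∈ Subgroup.closure s) : InvertibleMeasurePreserving σ μ := by
  induction hσ using Subgroup.closure_induction with
  | mem σ h => exact hs σ h
  | one => exact ⟨MeasurePreserving.id μ, MeasurePreserving.id μ⟩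
  | mul σ τ _ _ h1 h2 => exact ⟨h1.1.comp h2.1, h2.2.comp h1.2⟩
  | inv σ _ h => exact ⟨h.2, h.1⟩

lemma BddMeasurable.eLpNorm_two_eq {𝕜 : Type*} [RCLike 𝕜] [IsProbabilityMeasure μ] {f : X → 𝕜}
    (hf : BddMeasurable f) : eLpNorm f 2 μ = ENNReal.ofReal (√(∫ x, ‖f x‖ ^ 2 ∂μ)) := by
  rw [MemLp.eLpNorm_eq_integral_rpow_norm two_ne_zero ENNReal.ofNat_ne_top (hf.memLp μ 2)]
  simp [Real.sqrt_eq_rpow]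

end Translation

theorem theorem2p8 {𝕜 G X : Type*} [RCLike 𝕜]
    [MeasurableSpace X] (μ : Measure X) [IsProbabilityMeasure μ]
    [CommGroup G] [Module.Free ℤ (Additive G)] [Module.Finite ℤ (Additive G)]
    [MulAction G X]
    (hmp : ∀ g : G, MeasurePreserving (fun x : X => g • x) μ μ)
    (hwm : TotallyWeaklyMixing G μ)
    (k l : ℕ)
    (T : Fin k → G) (hT : ∀ j, T j ≠ 1)
    (S : Fin k → Equiv.Perm X) (hS : ∀ j, InvertibleMeasurePreserving (S j) μ)
    (hSS : ∀ i j, Commute (S i) (S j))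
    (hST : ∀ i j x, S i (T j • x) = T j • S i x)
    (P : Fin l → Fin k → ℤ → ℤ) (hP : ∀ i j, IsIntegerValuedPolynomial (P i j))
    (hnonconst : ∀ i, ¬ ∃ c : G, ∀ n : ℤ, polyExpr T (P i) n = c)
    (hdistinct : ∀ i j, i ≠ j →
      ¬ ∃ c : G, ∀ n : ℤ, polyExpr T (P i) n * (polyExpr T (P j) n)⁻¹ = c)
    (Q : Fin l → Fin k → ℕ → ℤ)
    (f : Fin l → X → 𝕜) (hf : ∀ i, Measurable (f i))
    (hfb : ∀ i, ∃ C : ℝ, ∀ x, ‖f i x‖ ≤ C) :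
    Tendsto
      (fun N : ℕ => eLpNorm (fun x => arrayAverage T S P Q f N x - ∏ i, ∫ y, f i y ∂μ) 2 μ)
      atTop (𝓝 0) := by
  -- `S` need only commute with the subgroup generated by `T`, so the polynomial sequences are
  -- regarded as taking values there.
  let U : Subgroup G := Subgroup.closure (Set.range T)
  let V : Subgroup (Equiv.Perm X) := Subgroup.closure (Set.range S)
  have hVcomm : IsMulCommutative V := Subgroup.isMulCommutative_closure <| by
    rintro _ ⟨i, rfl⟩ _ ⟨j, rfl⟩; exact hSS i j
  let _ : CommGroup V := { (inferInstance : Group V) with mul_comm := hVcomm.is_comm.comm }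
  have hUV : SMulCommClass U V X := ⟨fun g σ x =>
    (Subgroup.closure_commute_smul (by rintro _ ⟨i, rfl⟩ _ ⟨j, rfl⟩ x; exact hST i j x)
      σ.2 g.2 x).symm⟩
  let _ : AddAction (Additive U × Additive V) X := commutingAddAction U V X
  have hmp' : ∀ c : Additive U × Additive V, MeasurePreserving (fun x : X => c +ᵥ x) μ μ :=
    fun c => (hmp (c.1.toMul : G)).comp
      (InvertibleMeasurePreserving.of_mem_closure (by rintro _ ⟨j, rfl⟩; exact hS j)
        c.2.toMul.2).1
  have hwm' : ∀ a : Additive U, a ≠ 0 →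
      WeaklyMixing (fun x : X => (a, (0 : Additive V)) +ᵥ x) μ :=
    fun a ha => hwm (a.toMul : G) fun h => ha (Subtype.ext h)
  let F : Additive U →+ Additive G := MonoidHom.toAdditive U.subtype
  have hF : Function.Injective F := U.subtype_injective
  have htf : IsAddTorsionFree (Additive G) :=
    Module.isTorsionFree_int_iff_isAddTorsionFree.1 inferInstance
  have htf' : IsAddTorsionFree (Additive U) := hF.isAddTorsionFree F
  have hUmem : ∀ i n, polyExpr T (P i) n ∈ U := fun i n => Subgroup.prod_mem _ fun j _ =>
    Subgroup.zpow_mem _ (Subgroup.subset_closure (Set.mem_range_self j)) _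
  have hVmem : ∀ i N, hatExpr S (Q i) N ∈ V := fun i N => Subgroup.list_prod_mem _ fun σ hσ => by
    obtain ⟨j, rfl⟩ := (List.mem_ofFn' _ _).1 hσ
    exact Subgroup.zpow_mem _ (Subgroup.subset_closure (Set.mem_range_self j)) _
  let φ : Fin l → ℤ → Additive U := fun i n => Additive.ofMul ⟨polyExpr T (P i) n, hUmem i n⟩
  let ψ : Fin l → ℕ → Additive V := fun i N => Additive.ofMul ⟨hatExpr S (Q i) N, hVmem i N⟩
  have hpoly : ∀ i, ∃ d, iterDiff d (φ i) = 0 := fun i => by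
    obtain ⟨d, hd⟩ := polyExpr_exists_iterDiff_eq_zero T (hP i)
    refine ⟨d, funext fun n => hF ?_⟩
    rw [← iterDiff_map F d (φ i) n, Pi.zero_apply, map_zero]
    exact congrFun hd n
  choose d hd using hpoly
  have hadm : Admissible (∑ i, d i) Finset.univ φ := by
    refine ⟨fun i hi => iterDiff_eq_zero_of_le
      (Finset.single_le_sum (f := d) (fun _ _ => Nat.zero_le _) hi) (hd i), fun i _ h => ?_,
      fun i _ j _ hij h => ?_⟩
    · obtain ⟨c, hc⟩ := iterDiff_one_eq_zero_iff.1 h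
      exact hnonconst i ⟨(c.toMul : G), fun n => congrArg (fun a => (a.toMul : G)) (hc n)⟩
    · obtain ⟨c, hc⟩ := iterDiff_one_eq_zero_iff.1 h
      refine hdistinct i j hij ⟨(c.toMul : G), fun n => ?_⟩
      rw [← div_eq_mul_inv]
      exact congrArg (fun a => (a.toMul : G)) (hc n)
  have hfm : ∀ i, BddMeasurable (f i) := fun i => ⟨hf i, hfb i⟩
  have hconv := (hadm.convergesToProduct hmp' hwm' ψ hfm).sqrt
  rw [Real.sqrt_zero] at hconv
  have hlim := ENNReal.tendsto_ofReal hconv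
  rw [ENNReal.ofReal_zero] at hlim
  refine hlim.congr fun N => ?_
  rw [← ((bddMeasurable_familyAverage hmp' hfm N).sub (BddMeasurable.const _)).eLpNorm_two_eq]
  rfl
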